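/- Identify an integer partition $\lambda$ with its Ferrers diagram, whose boxes are indexed by (row, column), starting from $(1,1)$; $|\lambda|$ is the number of boxes. Let $\mathcal{SC}$ be the set of self-conjugate partitions, i.e. those whose diagram equals its transpose. The hook-length of a box $v$ of $\lambda$ is the number of boxes $u$ of $\lambda$ such that $u=v$, or $u$ lies strictly to the right of $v$ in the same row, or strictly below $v$ in the same column; for a positive integer $t$, $\mathcal H_t(\lambda)$ is the multiset of the hook-lengths of $\lambda$ that are divisible by $t$, and $|\mathcal H_t(\lambda)|$ is its number of elements, counted with multiplicity. The BG-rank of $\lambda$ is $\mathrm{BG}(\lambda)=\sum_{(i,j)\in\lambda}(-1)^{i+j}\in\mathbb Z$. For complex $a,q$ with $|q|<1$, put $(a;q)_\infty=\prod_{j\ge 0}(1-aq^j)$. Let $t$ be an even positive integer. Then for all complex numbers $q,x,b$ with $|q|<1$ and $b\neq 0$, the series on the left converges absolutely and $$\sum_{\lambda\in\mathcal{SC}}q^{|\lambda|}x^{|\mathcal H_t(\lambda)|}b^{\mathrm{BG}(\lambda)}\prod_{h\in\mathcal H_t(\lambda)}\frac1h=\left(q^{2t};q^{2t}\right)_\infty^{t/2}\left(-bq;q^4\right)_\infty\left(-q^3/b;q^4\right)_\infty\exp\left(\frac{x^2q^{2t}}{2t}\right).$$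 In particular, for every integer $j$ and every integer $n\ge 0$, $$\sum_{\substack{\lambda\in\mathcal{SC},\ |\lambda|=2tn+j(2j-1)\\ |\mathcal H_t(\lambda)|=2n,\ \mathrm{BG}(\lambda)=j}}\ \prod_{h\in\mathcal H_t(\lambda)}\frac1h=\frac{1}{n!\,2^n\,t^n}.$$ -/

import Mathlib

namespace YoungDiagram

/-- The hook-length of the box `v` in `μ`: the number of boxes `u` of `μ` such that `u = v`, or `u`
lies strictly to the right of `v` in the same row, or strictly below `v` in the same column.
(A box is a pair (row, column), both counted from `0`.) -/
def hookLength (μ : YoungDiagram) (v : ℕ × ℕ) : ℕ :=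
  (μ.cells.filter fun u =>
    u = v ∨ (u.1 = v.1 ∧ v.2 < u.2) ∨ (u.2 = v.2 ∧ v.1 < u.1)).card

/-- The multiset of all hook-lengths of `μ`. -/
def hookLengths (μ : YoungDiagram) : Multiset ℕ :=
  μ.cells.val.map μ.hookLength

/-- The multiset of all hook-lengths of `μ` that are divisible by `t`. -/
def hookLengthsMod (t : ℕ) (μ : YoungDiagram) : Multiset ℕ :=
  μ.hookLengths.filter (t ∣ ·)

/-- The BG-rank: the sum over all boxes of the signs `+1`, `-1` alternating along rows and columns,
starting with `+1` in the top left box. -/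
def bgRank (μ : YoungDiagram) : ℤ :=
  ∑ v ∈ μ.cells, (-1) ^ (v.1 + v.2)

/-- A partition is self-conjugate if its diagram is equal to its transpose. -/
def IsSelfConjugate (μ : YoungDiagram) : Prop :=
  μ.transpose = μ

theorem finite_selfConjugate_card_eq (N : ℕ) :
    {μ : YoungDiagram | μ.IsSelfConjugate ∧ μ.card = N}.Finite := by
  have hinj : Function.Injective YoungDiagram.cells := fun _ _ h => YoungDiagram.ext h
  refine Set.Finite.of_finite_image (f := YoungDiagram.cells)
    (Set.Finite.subset
      (Finset.finite_toSet ((Finset.range N ×ˢ Finset.range N).powerset)) ?_) hinj.injOn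
  rintro _ ⟨μ, ⟨-, rfl⟩, rfl⟩
  simp only [Finset.coe_powerset, Set.mem_preimage, Set.mem_powerset_iff, Finset.coe_subset]
  rintro ⟨i, j⟩ h
  rw [mem_cells] at h
  rw [Finset.mem_product, Finset.mem_range, Finset.mem_range]
  constructor
  · refine lt_of_lt_of_le (mem_iff_lt_colLen.1 h) ?_
    rw [colLen_eq_card]
    exact Finset.card_le_card (Finset.filter_subset _ _)
  · refine lt_of_lt_of_le (mem_iff_lt_rowLen.1 h) ?_
    rw [rowLen_eq_card]
    exact Finset.card_le_card (Finset.filter_subset _ _)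

/-- The finite set of self-conjugate partitions of `N`. -/
noncomputable def selfConjugateOfSize (N : ℕ) : Finset YoungDiagram :=
  (finite_selfConjugate_card_eq N).toFinset

end YoungDiagram

/-- The infinite `q`-Pochhammer symbol `(a; q)_∞ = ∏_{j ≥ 0} (1 - a q ^ j)`, for `‖q‖ < 1`. -/
noncomputable def qPochhammerInf (a q : ℂ) : ℂ :=
  ∏' j : ℕ, (1 - a * q ^ j)

/-- The product that defines `(a; q)_∞` converges for `‖q‖ < 1`. -/
theorem multipliable_qPochhammerInf (a : ℂ) {q : ℂ} (hq : ‖q‖ < 1) :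
    Multipliable fun j : ℕ => 1 - a * q ^ j := by
  have h : Summable fun j : ℕ => ‖-(a * q ^ j)‖ := by
    simpa only [norm_neg, norm_mul, norm_pow] using
      (summable_geometric_of_lt_one (norm_nonneg q) hq).mul_left ‖a‖
  simpa only [sub_eq_add_neg] using multipliable_one_add_of_summable h

section

open Finset Polynomial

/-- The product of `φ (x - m)` over `x ∈ X` and `m < x` with `m ∉ X`: the hook product of the
partition with beta-set `X`. -/
def betaProd {M : Type*} [CommMonoid M] (φ : ℕ → M) (X : Finset ℕ) : M :=
  ∏ x ∈ X, ∏ m ∈ range x \ X, φ (x - m)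

/-- The inverse of the product of the hook-lengths of the partition with beta-set `X`. -/
def betaWeight (X : Finset ℕ) : ℚ :=
  betaProd (fun h : ℕ => (h : ℚ)⁻¹) X

theorem betaWeight_insert {v : ℕ} {P : Finset ℕ} (hv : v ∉ P) :
    betaWeight (insert v P) =
      betaWeight P * (∏ z ∈ P, |(v : ℚ) - z|) * ((v.factorial : ℕ) : ℚ)⁻¹ := by
  unfold betaWeight betaProd
  rw [prod_insert hv]
  have h1 : ∏ m ∈ range v \ insert v P, (((v - m : ℕ) : ℚ))⁻¹ =
      ((v.factorial : ℕ) : ℚ)⁻¹ * ∏ z ∈ P, (if z < v then ((v - z : ℕ) : ℚ) else 1) := by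
    have e : range v \ insert v P = range v \ P := by
      ext m; simp only [mem_sdiff, mem_range, mem_insert]; grind
    have hf : ∏ m ∈ range v, (((v - m : ℕ) : ℚ))⁻¹ = ((v.factorial : ℕ) : ℚ)⁻¹ := by
      rw [prod_inv_distrib]; congr 1
      rw [← prod_range_reflect, ← prod_range_add_one_eq_factorial, Nat.cast_prod]
      refine prod_congr rfl fun m hm => ?_
      rw [mem_range] at hm
      congr 1; omega
    rw [e, ← hf, ← prod_filter, ← prod_sdiff (s₁ := range v ∩ P) (s₂ := range v) inter_subset_left]
    have e2 : P.filter (· < v) = range v ∩ P := by ext m; simp; tauto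
    rw [e2, sdiff_inter_self_left, mul_assoc, ← prod_mul_distrib, prod_eq_one (s := range v ∩ P),
      mul_one]
    intro m hm
    simp only [mem_inter, mem_range] at hm
    refine inv_mul_cancel₀ ?_
    have : v - m ≠ 0 := by omega
    exact_mod_cast this
  have h2 : ∏ x ∈ P, ∏ m ∈ range x \ insert v P, (((x - m : ℕ) : ℚ))⁻¹ =
      (∏ x ∈ P, ∏ m ∈ range x \ P, (((x - m : ℕ) : ℚ))⁻¹) *
        ∏ z ∈ P, (if v < z then ((z - v : ℕ) : ℚ) else 1) := by
    rw [← prod_mul_distrib]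
    refine prod_congr rfl fun x hx => ?_
    split_ifs with h
    · have : range x \ P = insert v (range x \ insert v P) := by
        ext m; simp only [mem_sdiff, mem_range, mem_insert]; grind
      rw [this, prod_insert (by simp), mul_right_comm, inv_mul_cancel₀, one_mul]
      have : x - v ≠ 0 := by omega
      exact_mod_cast this
    · rw [mul_one]
      refine prod_congr ?_ fun _ _ => rfl
      ext m; simp only [mem_sdiff, mem_range, mem_insert]; grind
  rw [h1, h2]
  have h3 : ∏ z ∈ P, |(v : ℚ) - z| = (∏ z ∈ P, (if z < v then ((v - z : ℕ) : ℚ) else 1)) *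
      ∏ z ∈ P, (if v < z then ((z - v : ℕ) : ℚ) else 1) := by
    rw [← prod_mul_distrib]
    refine prod_congr rfl fun z hz => ?_
    have : z ≠ v := fun h => hv (h ▸ hz)
    rcases lt_or_gt_of_ne this with h | h
    · rw [if_pos h, if_neg (by omega), Nat.cast_sub h.le, mul_one, abs_of_nonneg]
      have : (z : ℚ) < v := by exact_mod_cast h
      linarith
    · rw [if_pos h, if_neg (by omega), Nat.cast_sub h.le, one_mul, abs_of_nonpos, neg_sub]
      have : (v : ℚ) < z := by exact_mod_cast h
      linarith
  rw [h3]; ring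

theorem betaWeight_raise {Y : Finset ℕ} {y : ℕ} (hy : y ∈ Y) (hy' : y + 1 ∉ Y) :
    betaWeight (insert (y + 1) (Y.erase y)) =
      betaWeight Y * ((∏ z ∈ Y.erase y, (((y : ℚ) + 1 - z) / (y - z))) / (y + 1)) := by
  have h0 := betaWeight_insert (v := y) (P := Y.erase y) (notMem_erase _ _)
  rw [insert_erase hy] at h0
  rw [betaWeight_insert (by simp [hy']), h0, Nat.factorial_succ]
  have key : ∏ z ∈ Y.erase y, |((y + 1 : ℕ) : ℚ) - z| =
      (∏ z ∈ Y.erase y, |(y : ℚ) - z|) * ∏ z ∈ Y.erase y, (((y : ℚ) + 1 - z) / (y - z)) := by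
    rw [← prod_mul_distrib]
    refine prod_congr rfl fun z hz => ?_
    have hz1 : z ≠ y := ne_of_mem_erase hz
    have hz2 : z ≠ y + 1 := fun h => hy' (h ▸ mem_of_mem_erase hz)
    push_cast
    rcases lt_or_gt_of_ne hz1 with h | h
    · have : (z : ℚ) < y := by exact_mod_cast h
      rw [abs_of_pos (by linarith), abs_of_pos (by linarith), mul_div_cancel₀]
      linarith
    · have : (y : ℚ) + 1 < z := by
        have : y + 1 < z := by omega
        exact_mod_cast this
      have h0 : (y : ℚ) - z ≠ 0 := by linarith
      rw [abs_of_neg (by linarith), abs_of_neg (by linarith)]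
      field_simp
  rw [key]
  have := Nat.factorial_ne_zero y
  push_cast
  field_simp

theorem betaWeight_lower {X : Finset ℕ} {x : ℕ} (hx : x + 1 ∈ X) (hx' : x ∉ X) :
    betaWeight (insert x (X.erase (x + 1))) =
      betaWeight X * (((x : ℚ) + 1) * ∏ z ∈ X.erase (x + 1), (((x : ℚ) - z) / (x + 1 - z))) := by
  have hne : x ∉ X.erase (x + 1) := by simp [hx']
  have h := betaWeight_raise (Y := insert x (X.erase (x + 1))) (y := x) (mem_insert_self _ _)
    (by simp)
  rw [erase_insert hne, insert_erase hx] at h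
  rw [h]
  have : (∏ z ∈ X.erase (x + 1), (((x : ℚ) + 1 - z) / (x - z))) *
      ∏ z ∈ X.erase (x + 1), (((x : ℚ) - z) / (x + 1 - z)) = 1 := by
    rw [← prod_mul_distrib]
    refine prod_eq_one fun z hz => ?_
    have hz1 : z ≠ x + 1 := ne_of_mem_erase hz
    have hz2 : z ≠ x := fun h => hx' (h ▸ mem_of_mem_erase hz)
    have h1 : (x : ℚ) + 1 - z ≠ 0 := by
      intro h; apply hz1; have : (z : ℚ) = ((x + 1 : ℕ) : ℚ) := by push_cast; linarith
      exact_mod_cast this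
    have h2 : (x : ℚ) - z ≠ 0 := by
      intro h; apply hz2; have : (z : ℚ) = x := by linarith
      exact_mod_cast this
    field_simp
  have h1 : (x : ℚ) + 1 ≠ 0 := by positivity
  generalize betaWeight (insert x (X.erase (x + 1))) = W at *
  field_simp
  rw [mul_assoc, this, mul_one]

/-- Lagrange interpolation at the nodes `Y ∪ {-1}`. -/
theorem sum_raise_coeff {Y : Finset ℕ} (h0 : 0 ∈ Y) :
    ∑ y ∈ Y, (∏ z ∈ Y.erase y, (((y : ℚ) + 1 - z) / (y - z))) / (y + 1) = 1 := by
  set s : Finset ℤ := insert (-1) (Y.map Nat.castEmbedding) with hs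
  have hn : (-1 : ℤ) ∉ Y.map Nat.castEmbedding := by simp
  set P : ℚ[X] := ∏ z ∈ Y, (X - C ((z : ℚ) - 1)) with hP
  have hPm : P.Monic := monic_prod_of_monic _ _ fun _ _ => monic_X_sub_C _
  have hPd : P.degree = #Y := by
    rw [hP, degree_prod]; simp only [degree_X_sub_C]; simp
  have hcard : #s = #Y + 1 := by rw [hs, card_insert_of_notMem hn, card_map]
  have hinj : Set.InjOn (fun i : ℤ => (i : ℚ)) s := fun a _ b _ h => Int.cast_injective h
  have := Lagrange.leadingCoeff_eq_sum (P := P) hinj (by rw [hcard, hPd]; rfl)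
  rw [hPm.leadingCoeff, hs, sum_insert hn, sum_map] at this
  have e0 : P.eval (((-1 : ℤ) : ℚ)) = 0 := by
    rw [hP, eval_prod]; exact prod_eq_zero h0 (by simp)
  rw [e0, zero_div, zero_add] at this
  refine Eq.trans (sum_congr rfl fun y hy => ?_) this.symm
  have hy' : ((y : ℕ) : ℤ) ∈ Y.map Nat.castEmbedding := by simpa using hy
  have e1 : (insert (-1) (Y.map Nat.castEmbedding)).erase (Nat.castEmbedding y : ℤ) =
      insert (-1) ((Y.erase y).map Nat.castEmbedding) := by
    ext a; simp only [mem_erase, mem_insert, mem_map, Nat.castEmbedding_apply]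
    constructor
    · rintro ⟨h1, rfl | ⟨b, hb, rfl⟩⟩
      · exact Or.inl rfl
      · exact Or.inr ⟨b, ⟨fun h => h1 (by rw [h]), hb⟩, rfl⟩
    · rintro (rfl | ⟨b, ⟨hb1, hb⟩, rfl⟩)
      · exact ⟨by omega, Or.inl rfl⟩
      · exact ⟨fun h => hb1 (by exact_mod_cast h), Or.inr ⟨b, hb, rfl⟩⟩
  rw [e1, prod_insert (by simp), prod_map, hP, eval_prod, ← mul_prod_erase _ _ hy, prod_div_distrib]
  simp only [Nat.castEmbedding_apply, eval_sub, eval_X, eval_C]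
  have hne : ∏ x ∈ Y.erase y, ((y : ℚ) - x) ≠ 0 := prod_ne_zero_iff.2 fun z hz h => by
    have : (y : ℚ) = z := by linarith
    exact ne_of_mem_erase hz (by exact_mod_cast this.symm)
  have : (y : ℚ) + 1 ≠ 0 := by positivity
  have e2 : ∀ x : ℕ, (y : ℚ) - (x - 1) = y + 1 - x := fun x => by ring
  push_cast
  simp only [e2, sub_neg_eq_add]
  field_simp
  ring

theorem exists_lower_poly (Y : Finset ℕ) : ∃ R : ℚ[X], R.degree < #Y ∧
    R = X * (∏ z ∈ Y, (X - C ((z : ℚ) + 1)) - ∏ z ∈ Y, (X - C (z : ℚ))) +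
      C (#Y : ℚ) * ∏ z ∈ Y, (X - C (z : ℚ)) ∧
    R.coeff (#Y - 1) = (#Y).choose 2 - ∑ z ∈ Y, (z : ℚ) := by
  induction Y using Finset.induction_on with
  | empty => exact ⟨0, by simp⟩
  | insert w Y hw ih =>
    obtain ⟨R, hd, hR, hc⟩ := ih
    set M : ℚ[X] := ∏ z ∈ Y, (X - C (z : ℚ)) with hM
    set N : ℚ[X] := ∏ z ∈ Y, (X - C ((z : ℚ) + 1)) with hN
    have hMm : M.Monic := monic_prod_of_monic _ _ fun _ _ => monic_X_sub_C _
    have hMd : M.degree = #Y := by rw [hM, degree_prod]; simp only [degree_X_sub_C]; simp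
    have hMc : M.coeff #Y = 1 := by
      have := hMm.coeff_natDegree
      rwa [natDegree_eq_of_degree_eq_some hMd] at this
    refine ⟨(X - C ((w : ℚ) + 1)) * R + C ((#Y : ℚ) - w) * M, ?_, ?_, ?_⟩
    · rw [card_insert_of_notMem hw]
      refine (degree_add_le _ _).trans_lt (max_lt ?_ ?_)
      · rw [degree_mul, degree_X_sub_C, add_comm]
        rcases eq_or_ne R 0 with h | h
        · rw [h, degree_zero, WithBot.bot_add]; exact WithBot.bot_lt_coe _
        · rw [degree_eq_natDegree h] at hd ⊢
          norm_cast at hd ⊢; omega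
      · refine (degree_mul_le _ _).trans_lt ?_
        refine (add_le_add_left degree_C_le _).trans_lt ?_
        rw [hMd, zero_add]; norm_cast; omega
    · rw [prod_insert hw, prod_insert hw, card_insert_of_notMem hw, ← hM, ← hN, hR]
      simp only [map_add, map_sub, Nat.cast_add, Nat.cast_one, map_one]
      ring
    · have hRc : R.coeff #Y = 0 := coeff_eq_zero_of_degree_lt hd
      rw [card_insert_of_notMem hw, sum_insert hw, Nat.add_sub_cancel, coeff_add, coeff_C_mul, hMc,
        sub_mul, coeff_sub, coeff_C_mul, hRc]
      have hX : (X * R).coeff #Y = (#Y).choose 2 - ∑ z ∈ Y, (z : ℚ) := by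
        rcases Nat.eq_zero_or_pos #Y with h | h
        · rw [h, mul_coeff_zero]; simp [card_eq_zero.1 h]
        · obtain ⟨k, hk⟩ := Nat.exists_eq_succ_of_ne_zero h.ne'
          rw [← hc, hk]; simp
      rw [hX, Nat.choose_succ_succ' , Nat.choose_one_right]
      push_cast; ring

theorem sum_lower_coeff (Y : Finset ℕ) :
    ∑ y ∈ Y, (y : ℚ) * ∏ z ∈ Y.erase y, (((y : ℚ) - 1 - z) / (y - z)) =
      ∑ z ∈ Y, (z : ℚ) - (#Y).choose 2 := by
  obtain ⟨R, hd, hR, hc⟩ := exists_lower_poly Y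
  have hinj : Set.InjOn (fun i : ℕ => (i : ℚ)) Y := fun a _ b _ h => Nat.cast_injective h
  have := Lagrange.coeff_eq_sum hinj hd
  rw [hc] at this
  rw [← neg_inj, neg_sub, this, ← sum_neg_distrib]
  refine sum_congr rfl fun y hy => ?_
  have e : R.eval (y : ℚ) = y * ∏ z ∈ Y, ((y : ℚ) - (z + 1)) := by
    have : ∏ z ∈ Y, ((y : ℚ) - z) = 0 := prod_eq_zero hy (by simp)
    rw [hR]; simp [eval_prod, this]
  have e2 : ∀ x : ℕ, (y : ℚ) - (x + 1) = y - 1 - x := fun x => by ring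
  rw [e, ← mul_prod_erase _ _ hy, prod_div_distrib]
  simp only [e2]
  ring

end

section

open Finset

theorem sum_betaWeight_raise {Y : Finset ℕ} (h0 : 0 ∈ Y) :
    ∑ y ∈ Y.filter (fun y => y + 1 ∉ Y), betaWeight (insert (y + 1) (Y.erase y)) =
      betaWeight Y := by
  conv_rhs => rw [← mul_one (betaWeight Y), ← sum_raise_coeff h0, mul_sum]
  rw [sum_filter]
  refine sum_congr rfl fun y hy => ?_
  split_ifs with h
  · rw [prod_eq_zero (i := y + 1) (by simp [h]) (by simp)]
    simp
  · exact betaWeight_raise hy h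

theorem sum_betaWeight_lower (X : Finset ℕ) :
    ∑ x ∈ X.filter (fun x => 0 < x ∧ x - 1 ∉ X), betaWeight (insert (x - 1) (X.erase x)) =
      (∑ x ∈ X, (x : ℚ) - (#X).choose 2) * betaWeight X := by
  rw [← sum_lower_coeff, mul_comm, mul_sum, sum_filter]
  refine sum_congr rfl fun x hx => ?_
  rcases x with _ | x
  · simp
  simp only [Nat.add_sub_cancel, Nat.succ_pos, true_and, Nat.cast_add, Nat.cast_one,
    add_sub_cancel_right]
  split_ifs with h
  · rw [prod_eq_zero (i := x) (by simp [h]) (by simp)]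
    simp
  · exact betaWeight_lower hx h

/-- The beta-sets with `k` elements of the partitions of `n`. -/
def betaSets (k n : ℕ) : Finset (Finset ℕ) :=
  (range (n + k.choose 2 + 1)).powerset.filter fun X => #X = k ∧ ∑ x ∈ X, x = n + k.choose 2

theorem mem_betaSets {k n : ℕ} {X : Finset ℕ} :
    X ∈ betaSets k n ↔ #X = k ∧ ∑ x ∈ X, x = n + k.choose 2 := by
  simp only [betaSets, mem_filter, mem_powerset, and_iff_right_iff_imp]
  rintro ⟨-, h⟩ x hx
  have := single_le_sum (f := fun x => x) (fun _ _ => Nat.zero_le _) hx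
  simp only [mem_range]; omega

/-- The number of hooks of the partition with beta-set `X`, which is its size. -/
def gapCount (X : Finset ℕ) : ℕ :=
  ∑ x ∈ X, #(range x \ X)

theorem gapCount_add_choose (X : Finset ℕ) : gapCount X + (#X).choose 2 = ∑ x ∈ X, x := by
  induction X using Finset.induction_on_max with
  | empty => simp [gapCount]
  | insert m X hX ih =>
    have hm : m ∉ X := fun h => lt_irrefl _ (hX m h)
    have hsub : X ⊆ range m := fun x hx => mem_range.2 (hX x hx)
    have hle : #X ≤ m := by simpa using card_le_card hsub
    rw [gapCount, sum_insert hm, sum_insert hm, card_insert_of_notMem hm, ← ih,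
      Nat.choose_succ_succ', Nat.choose_one_right]
    have h1 : range m \ insert m X = range m \ X := by
      ext a; simp only [mem_sdiff, mem_range, mem_insert]; grind
    have h2 : ∑ x ∈ X, #(range x \ insert m X) = gapCount X := by
      refine sum_congr rfl fun x hx => congrArg card ?_
      have := hX x hx
      ext a; simp only [mem_sdiff, mem_range, mem_insert]; grind
    rw [h1, h2, card_sdiff_of_subset hsub, card_range]
    simp only [Nat.reduceAdd]
    omega

theorem mem_betaSets_iff_gapCount {k n : ℕ} {X : Finset ℕ} :
    X ∈ betaSets k n ↔ #X = k ∧ gapCount X = n := by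
  rw [mem_betaSets]
  refine and_congr_right fun h => ?_
  rw [← gapCount_add_choose, h]; omega

theorem eq_range_of_gapCount_eq_zero {X : Finset ℕ} (h : gapCount X = 0) : X = range #X := by
  have hsub : X ⊆ range #X := fun x hx => by
    have h1 := (sum_eq_zero_iff.1 h) x hx
    rw [card_eq_zero, sdiff_eq_empty_iff_subset] at h1
    have h2 : range (x + 1) ⊆ X := by
      rw [range_add_one]; exact insert_subset hx h1
    have := card_le_card h2
    rw [card_range] at this
    exact mem_range.2 this
  exact eq_of_subset_of_card_le hsub (by simp)

theorem gapCount_range (k : ℕ) : gapCount (range k) = 0 :=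
  sum_eq_zero fun x hx => by
    rw [card_eq_zero, sdiff_eq_empty_iff_subset]
    exact range_mono (mem_range.1 hx).le

theorem betaSets_zero (k : ℕ) : betaSets k 0 = {range k} := by
  ext X
  rw [mem_betaSets_iff_gapCount, mem_singleton]
  constructor
  · rintro ⟨rfl, h⟩
    exact eq_range_of_gapCount_eq_zero h
  · rintro rfl
    exact ⟨card_range k, gapCount_range k⟩

theorem betaWeight_range (k : ℕ) : betaWeight (range k) = 1 := by
  unfold betaWeight betaProd
  refine prod_eq_one fun x hx => ?_
  rw [sdiff_eq_empty_iff_subset.2 (range_mono (mem_range.1 hx).le), prod_empty]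

theorem zero_mem_of_gapCount_lt {X : Finset ℕ} (h : gapCount X < #X) : 0 ∈ X := by
  by_contra h0
  refine absurd h (not_lt.2 ?_)
  rw [card_eq_sum_ones]
  refine sum_le_sum fun x hx => card_pos.2 ⟨0, ?_⟩
  have : x ≠ 0 := fun h => h0 (h ▸ hx)
  simp [h0]; omega

theorem sum_sq_betaWeight_succ {k n : ℕ} (h : n < k) :
    ((n : ℚ) + 1) * ∑ X ∈ betaSets k (n + 1), betaWeight X ^ 2 =
      ∑ Y ∈ betaSets k n, betaWeight Y ^ 2 := by
  have hL : ((n : ℚ) + 1) * ∑ X ∈ betaSets k (n + 1), betaWeight X ^ 2 =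
      ∑ X ∈ betaSets k (n + 1), ∑ x ∈ X.filter (fun x => 0 < x ∧ x - 1 ∉ X),
        betaWeight X * betaWeight (insert (x - 1) (X.erase x)) := by
    rw [mul_sum]
    refine sum_congr rfl fun X hX => ?_
    rw [← mul_sum, sum_betaWeight_lower]
    obtain ⟨h1, h2⟩ := mem_betaSets.1 hX
    have : (∑ x ∈ X, (x : ℚ)) = n + 1 + k.choose 2 := by
      rw [← Nat.cast_sum, h2]; push_cast; rfl
    rw [this, h1]; ring
  have hR : ∑ Y ∈ betaSets k n, betaWeight Y ^ 2 =
      ∑ Y ∈ betaSets k n, ∑ y ∈ Y.filter (fun y => y + 1 ∉ Y),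
        betaWeight Y * betaWeight (insert (y + 1) (Y.erase y)) := by
    refine sum_congr rfl fun Y hY => ?_
    obtain ⟨h1, h2⟩ := mem_betaSets_iff_gapCount.1 hY
    rw [← mul_sum, sum_betaWeight_raise (zero_mem_of_gapCount_lt (by omega)), sq]
  rw [hL, hR, sum_sigma', sum_sigma']
  refine sum_nbij' (fun p => ⟨insert (p.2 - 1) (p.1.erase p.2), p.2 - 1⟩)
    (fun p => ⟨insert (p.2 + 1) (p.1.erase p.2), p.2 + 1⟩) ?_ ?_ ?_ ?_ ?_
  · rintro ⟨X, x⟩ hp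
    simp only [mem_sigma, mem_filter, mem_betaSets] at hp ⊢
    obtain ⟨⟨h1, h2⟩, hx, h0, hx'⟩ := hp
    have hne : x - 1 ∉ X.erase x := by simp [hx']
    have := add_sum_erase X (fun x => x) hx
    refine ⟨⟨?_, ?_⟩, mem_insert_self _ _, ?_⟩
    · rw [card_insert_of_notMem hne, card_erase_add_one hx, h1]
    · rw [sum_insert hne]; omega
    · rw [Nat.sub_add_cancel h0]; simp; omega
  · rintro ⟨Y, y⟩ hp
    simp only [mem_sigma, mem_filter, mem_betaSets] at hp ⊢
    obtain ⟨⟨h1, h2⟩, hy, hy'⟩ := hp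
    have hne : y + 1 ∉ Y.erase y := by simp [hy']
    have := add_sum_erase Y (fun x => x) hy
    refine ⟨⟨?_, ?_⟩, mem_insert_self _ _, by omega, by simp⟩
    · rw [card_insert_of_notMem hne, card_erase_add_one hy, h1]
    · rw [sum_insert hne]; omega
  · rintro ⟨X, x⟩ hp
    simp only [mem_sigma, mem_filter] at hp
    obtain ⟨-, hx, h0, hx'⟩ := hp
    have hne : x - 1 ∉ X.erase x := by simp [hx']
    simp only [Nat.sub_add_cancel h0, erase_insert hne, insert_erase hx]
  · rintro ⟨Y, y⟩ hp
    simp only [mem_sigma, mem_filter] at hp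
    obtain ⟨-, hy, hy'⟩ := hp
    have hne : y + 1 ∉ Y.erase y := by simp [hy']
    simp only [Nat.add_sub_cancel, erase_insert hne, insert_erase hy]
  · rintro ⟨X, x⟩ hp
    simp only [mem_sigma, mem_filter] at hp
    obtain ⟨-, hx, h0, hx'⟩ := hp
    have hne : x - 1 ∉ X.erase x := by simp [hx']
    simp only [Nat.sub_add_cancel h0, erase_insert hne, insert_erase hx]
    ring

/-- The identity `∑ (f^λ)² = n!` together with the hook-length formula. -/
theorem sum_sq_betaWeight {k n : ℕ} (h : n ≤ k) :
    ∑ X ∈ betaSets k n, betaWeight X ^ 2 = 1 / (n.factorial : ℚ) := by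
  induction n with
  | zero => simp [betaSets_zero, betaWeight_range]
  | succ n ih =>
    have h1 := sum_sq_betaWeight_succ (k := k) (n := n) h
    rw [ih (by omega)] at h1
    have : (n : ℚ) + 1 ≠ 0 := by positivity
    rw [eq_div_iff (by positivity), Nat.factorial_succ]
    rw [eq_div_iff (by positivity)] at h1
    push_cast
    linear_combination h1

theorem card_betaSets_succ (k n : ℕ) :
    #(betaSets (k + 1) n) =
      #(betaSets k n) + if k + 1 ≤ n then #(betaSets (k + 1) (n - (k + 1))) else 0 := by
  classical
  have hk : (k + 1).choose 2 = k + k.choose 2 := by simp [Nat.choose_succ_succ' k 1]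
  have hinj : Function.Injective (fun x : ℕ => x + 1) := fun a b h => by simpa using h
  have himg : Function.Injective (fun X : Finset ℕ => X.image (· + 1)) := image_injective hinj
  have h0 : ∀ X : Finset ℕ, 0 ∉ X.image (· + 1) := by simp
  have hsum : ∀ X : Finset ℕ, ∑ x ∈ X.image (· + 1), x = ∑ x ∈ X, x + #X := fun X => by
    rw [sum_image hinj.injOn, sum_add_distrib]; simp
  have hsurj : ∀ X : Finset ℕ, 0 ∉ X → (X.image (· - 1)).image (· + 1) = X := fun X hX => by
    ext a
    simp only [mem_image, exists_exists_and_eq_and]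
    constructor
    · rintro ⟨b, hb, rfl⟩
      have : b ≠ 0 := fun h => hX (h ▸ hb)
      rwa [Nat.sub_add_cancel (by omega)]
    · intro ha
      have : a ≠ 0 := fun h => hX (h ▸ ha)
      exact ⟨a, ha, by omega⟩
  have hc : ∀ X : Finset ℕ, #(X.image (· + 1)) = #X := fun X => card_image_of_injective _ hinj
  have e : betaSets (k + 1) n =
      (betaSets k n).image (fun X => insert 0 (X.image (· + 1))) ∪
        (if k + 1 ≤ n then betaSets (k + 1) (n - (k + 1)) else ∅).image
          (fun X => X.image (· + 1)) := by
    have hif : ∀ Y, Y ∈ (if k + 1 ≤ n then betaSets (k + 1) (n - (k + 1)) else ∅) ↔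
        k + 1 ≤ n ∧ #Y = k + 1 ∧ ∑ x ∈ Y, x = n - (k + 1) + (k + 1).choose 2 := fun Y => by
      split_ifs with h <;> simp [mem_betaSets, h]
    ext X
    simp only [mem_union, mem_image, hif, mem_betaSets, hk]
    constructor
    · rintro ⟨h1, h2⟩
      by_cases hX : 0 ∈ X
      · left
        have hs := hsurj (X.erase 0) (by simp)
        have hs1 := hsum ((X.erase 0).image (· - 1))
        have hs2 := hc ((X.erase 0).image (· - 1))
        rw [hs] at hs1 hs2
        have h3 := card_erase_add_one hX
        have h4 := add_sum_erase X (fun x => x) hX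
        exact ⟨(X.erase 0).image (· - 1), ⟨by omega, by omega⟩, by rw [hs, insert_erase hX]⟩
      · right
        have hs := hsurj X hX
        have hs1 := hsum (X.image (· - 1))
        have hs2 := hc (X.image (· - 1))
        rw [hs] at hs1 hs2
        have hle : k + 1 ≤ n := by
          by_contra hlt
          have hg := gapCount_add_choose X
          rw [h1, h2, hk] at hg
          exact hX (zero_mem_of_gapCount_lt (by omega))
        exact ⟨X.image (· - 1), ⟨hle, by omega, by omega⟩, hs⟩
    · rintro (⟨Y, ⟨h1, h2⟩, rfl⟩ | ⟨Y, ⟨h3, h1, h2⟩, rfl⟩)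
      · rw [card_insert_of_notMem (h0 Y), sum_insert (h0 Y), hc, hsum]
        exact ⟨by omega, by omega⟩
      · rw [hc, hsum]
        exact ⟨by omega, by omega⟩
  rw [e, card_union_of_disjoint, card_image_of_injective _ himg, card_image_of_injective]
  · split_ifs <;> simp
  · intro X Y h
    have := congrArg (fun Z => Finset.erase Z 0) h
    dsimp only at this
    rw [erase_insert (h0 X), erase_insert (h0 Y)] at this
    exact himg this
  · rw [disjoint_left]
    intro X hX hX'
    obtain ⟨Y, -, rfl⟩ := mem_image.1 hX
    obtain ⟨Z, -, h⟩ := mem_image.1 hX'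
    exact h0 Z (h ▸ mem_insert_self 0 _)

theorem two_mul_choose_two (k : ℕ) : 2 * (k.choose 2 : ℤ) = k * (k - 1) := by
  induction k with
  | zero => simp
  | succ k ih =>
    rw [Nat.choose_succ_succ', Nat.choose_one_right]
    push_cast
    linear_combination ih

/-- The hook product of the Maya diagram with particles `A` at nonnegative positions and holes
`-1 - b`, `b ∈ B`, at negative positions. -/
def hookProd {M : Type*} [CommMonoid M] (φ : ℕ → M) (p : Finset ℕ × Finset ℕ) : M :=
  (∏ a ∈ p.1, ∏ b ∈ p.2, φ (a + b + 1)) * betaProd φ p.1 * betaProd φ p.2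

/-- The number of hooks of the Maya diagram `p`. -/
def hookCount (p : Finset ℕ × Finset ℕ) : ℕ :=
  #p.1 * #p.2 + gapCount p.1 + gapCount p.2

/-- The charge of the Maya diagram `p`. -/
def charge (p : Finset ℕ × Finset ℕ) : ℤ :=
  #p.1 - #p.2

/-- Twice the energy of the Maya diagram `p`. -/
def energy (p : Finset ℕ × Finset ℕ) : ℕ :=
  ∑ a ∈ p.1, (2 * a + 1) + ∑ b ∈ p.2, (2 * b + 1)

theorem betaProd_const {M : Type*} [CommMonoid M] (x : M) (X : Finset ℕ) :
    betaProd (fun _ => x) X = x ^ gapCount X := by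
  simp [betaProd, gapCount, prod_pow_eq_pow_sum]

theorem hookProd_const {M : Type*} [CommMonoid M] (x : M) (p : Finset ℕ × Finset ℕ) :
    hookProd (fun _ => x) p = x ^ hookCount p := by
  simp only [hookProd, betaProd_const, prod_const, hookCount, pow_add, ← pow_mul, mul_comm (#p.1)]

theorem hookProd_mul {M : Type*} [CommMonoid M] (φ ψ : ℕ → M) (p : Finset ℕ × Finset ℕ) :
    hookProd (fun h => φ h * ψ h) p = hookProd φ p * hookProd ψ p := by
  simp only [hookProd, betaProd, prod_mul_distrib]
  ac_rfl

theorem map_hookProd {M N : Type*} [CommMonoid M] [CommMonoid N] (f : M →* N) (φ : ℕ → M)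
    (p : Finset ℕ × Finset ℕ) : f (hookProd φ p) = hookProd (fun h => f (φ h)) p := by
  simp only [hookProd, betaProd, map_mul, map_prod]

theorem energy_eq (p : Finset ℕ × Finset ℕ) :
    (energy p : ℤ) = charge p ^ 2 + 2 * hookCount p := by
  have h : ∀ X : Finset ℕ, ((∑ a ∈ X, (2 * a + 1) : ℕ) : ℤ) = 2 * gapCount X + (#X : ℤ) ^ 2 := by
    intro X
    have h1 := gapCount_add_choose X
    have h2 := two_mul_choose_two #X
    rw [sum_add_distrib, ← mul_sum, ← h1]
    push_cast
    simp only [sum_const, nsmul_eq_mul, mul_one]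
    linear_combination h2
  rw [energy, Nat.cast_add, h, h, charge, hookCount]
  push_cast
  ring

/-- The beta-set of `p` obtained by cutting off at level `-L`. -/
def betaSetOf (L : ℕ) (p : Finset ℕ × Finset ℕ) : Finset ℕ :=
  p.1.image (· + L) ∪ (range L \ p.2).image (L - 1 - ·)

/-- The pair with beta-set `X` at cut-off level `-L`. -/
def ofBetaSet (L : ℕ) (X : Finset ℕ) : Finset ℕ × Finset ℕ :=
  ((X.filter (L ≤ ·)).image (· - L), (range L \ X).image (L - 1 - ·))

theorem mem_betaSetOf {L : ℕ} {p : Finset ℕ × Finset ℕ} {x : ℕ} :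
    x ∈ betaSetOf L p ↔ (L ≤ x ∧ x - L ∈ p.1) ∨ (x < L ∧ L - 1 - x ∉ p.2) := by
  simp only [betaSetOf, mem_union, mem_image, mem_sdiff, mem_range]
  constructor
  · rintro (⟨a, ha, rfl⟩ | ⟨m, ⟨hm, hm'⟩, rfl⟩)
    · left; simpa using ha
    · right; refine ⟨by omega, ?_⟩
      rwa [show L - 1 - (L - 1 - m) = m by omega]
  · rintro (⟨h, h'⟩ | ⟨h, h'⟩)
    · exact Or.inl ⟨x - L, h', by omega⟩
    · exact Or.inr ⟨L - 1 - x, ⟨by omega, h'⟩, by omega⟩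

theorem mem_ofBetaSet_fst {L : ℕ} {X : Finset ℕ} {a : ℕ} : a ∈ (ofBetaSet L X).1 ↔ a + L ∈ X := by
  simp only [ofBetaSet, mem_image, mem_filter]
  constructor
  · rintro ⟨x, ⟨hx, h⟩, rfl⟩; rwa [Nat.sub_add_cancel h]
  · intro h; exact ⟨a + L, ⟨h, by omega⟩, by omega⟩

theorem mem_ofBetaSet_snd {L : ℕ} {X : Finset ℕ} {b : ℕ} :
    b ∈ (ofBetaSet L X).2 ↔ b < L ∧ L - 1 - b ∉ X := by
  simp only [ofBetaSet, mem_image, mem_sdiff, mem_range]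
  constructor
  · rintro ⟨x, ⟨hx, h⟩, rfl⟩
    refine ⟨by omega, ?_⟩
    rwa [show L - 1 - (L - 1 - x) = x by omega]
  · rintro ⟨h, h'⟩; exact ⟨L - 1 - b, ⟨by omega, h'⟩, by omega⟩

theorem betaSetOf_ofBetaSet (L : ℕ) (X : Finset ℕ) : betaSetOf L (ofBetaSet L X) = X := by
  ext x
  rw [mem_betaSetOf, mem_ofBetaSet_fst, mem_ofBetaSet_snd]
  rcases lt_or_ge x L with h | h
  · have : L - 1 - (L - 1 - x) = x := by omega
    simp only [this]; grind
  · rw [Nat.sub_add_cancel h]; grind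

theorem ofBetaSet_betaSetOf {L : ℕ} {p : Finset ℕ × Finset ℕ} (h : p.2 ⊆ range L) :
    ofBetaSet L (betaSetOf L p) = p := by
  refine Prod.ext ?_ ?_
  · ext a; rw [mem_ofBetaSet_fst, mem_betaSetOf]; simp
  · ext b; rw [mem_ofBetaSet_snd, mem_betaSetOf]
    have hb : b ∈ p.2 → b < L := fun hb => mem_range.1 (h hb)
    constructor
    · rintro ⟨h1, h2⟩
      rw [show L - 1 - (L - 1 - b) = b by omega] at h2
      by_contra h3
      exact h2 (Or.inr ⟨by omega, h3⟩)
    · intro h1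
      have := hb h1
      refine ⟨this, ?_⟩
      rw [show L - 1 - (L - 1 - b) = b by omega]
      rintro (h2 | h2)
      · omega
      · exact h2.2 h1

theorem prod_betaSetOf {M : Type*} [CommMonoid M] (L : ℕ) (p : Finset ℕ × Finset ℕ) (g : ℕ → M) :
    ∏ x ∈ betaSetOf L p, g x = (∏ a ∈ p.1, g (a + L)) * ∏ m ∈ range L \ p.2, g (L - 1 - m) := by
  rw [betaSetOf, prod_union, prod_image, prod_image]
  · intro a ha b hb h
    simp only [coe_sdiff, Set.mem_sdiff, mem_coe, mem_range] at ha hb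
    dsimp only at h; omega
  · intro a _ b _ h; simpa using h
  · rw [disjoint_left]
    intro x hx hx'
    simp only [mem_image, mem_sdiff, mem_range] at hx hx'
    omega

theorem card_betaSetOf {L : ℕ} {p : Finset ℕ × Finset ℕ} (h : p.2 ⊆ range L) :
    (#(betaSetOf L p) : ℤ) = L + charge p := by
  have := card_le_card h
  rw [card_range] at this
  rw [card_eq_sum_ones, ← toAdd_ofAdd (∑ _ ∈ _, 1), ofAdd_sum, prod_betaSetOf]
  simp [card_sdiff_of_subset h, charge, this]
  ring

theorem betaProd_betaSetOf {M : Type*} [CommMonoid M] (φ : ℕ → M) {L : ℕ}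
    {p : Finset ℕ × Finset ℕ} (h : p.2 ⊆ range L) :
    betaProd φ (betaSetOf L p) = hookProd φ p := by
  rw [betaProd, prod_betaSetOf, hookProd, betaProd, ← prod_mul_distrib]
  congr 1
  · refine prod_congr rfl fun a ha => ?_
    have e : range (a + L) \ betaSetOf L p =
        p.2.image (L - 1 - ·) ∪ (range a \ p.1).image (· + L) := by
      ext x
      simp only [mem_sdiff, mem_range, mem_betaSetOf, mem_union, mem_image]
      constructor
      · rintro ⟨h1, h2⟩
        push Not at h2
        rcases lt_or_ge x L with hx | hx
        · exact Or.inl ⟨L - 1 - x, h2.2 hx, by omega⟩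
        · exact Or.inr ⟨x - L, ⟨by omega, h2.1 hx⟩, by omega⟩
      · rintro (⟨b, hb, rfl⟩ | ⟨n, ⟨hn, hn'⟩, rfl⟩)
        · have := mem_range.1 (h hb)
          refine ⟨by omega, ?_⟩
          rw [show L - 1 - (L - 1 - b) = b by omega]
          rintro (h2 | h2)
          · omega
          · exact h2.2 hb
        · refine ⟨by omega, ?_⟩
          rintro (h2 | h2)
          · simp at h2; exact hn' h2
          · omega
    rw [e, prod_union, prod_image, prod_image]
    · congr 1
      · refine prod_congr rfl fun b hb => ?_
        have := mem_range.1 (h hb)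
        congr 1; omega
      · refine prod_congr rfl fun b hb => ?_
        congr 1; omega
    · intro a _ b _ h; simpa using h
    · intro a ha b hb h'
      have := mem_range.1 (h ha)
      have := mem_range.1 (h hb)
      dsimp only at h'; omega
    · rw [disjoint_left]
      intro x hx hx'
      simp only [mem_image, mem_sdiff, mem_range] at hx hx'
      obtain ⟨b, hb, rfl⟩ := hx
      have := mem_range.1 (h hb)
      omega
  · have e : ∀ m ∈ range L \ p.2, ∏ n ∈ range (L - 1 - m) \ betaSetOf L p, φ (L - 1 - m - n) =
        ∏ b ∈ p.2.filter (m < ·), φ (b - m) := by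
      intro m hm
      simp only [mem_sdiff, mem_range] at hm
      have e : range (L - 1 - m) \ betaSetOf L p = (p.2.filter (m < ·)).image (L - 1 - ·) := by
        ext x
        simp only [mem_sdiff, mem_range, mem_betaSetOf, mem_image, mem_filter]
        constructor
        · rintro ⟨h1, h2⟩
          push Not at h2
          exact ⟨L - 1 - x, ⟨h2.2 (by omega), by omega⟩, by omega⟩
        · rintro ⟨b, ⟨hb, hb'⟩, rfl⟩
          have := mem_range.1 (h hb)
          refine ⟨by omega, ?_⟩
          rw [show L - 1 - (L - 1 - b) = b by omega]
          rintro (h2 | h2)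
          · omega
          · exact h2.2 hb
      rw [e, prod_image]
      · refine prod_congr rfl fun b hb => ?_
        have hb := (mem_filter.1 hb)
        have := mem_range.1 (h hb.1)
        congr 1; omega
      · intro a ha b hb h'
        simp only [coe_filter, Set.mem_ofPred_eq] at ha hb
        have := mem_range.1 (h ha.1)
        have := mem_range.1 (h hb.1)
        dsimp only at h'; omega
    rw [prod_congr rfl e, betaProd]
    refine prod_comm' fun m b => ?_
    simp only [mem_sdiff, mem_range, mem_filter]
    constructor
    · rintro ⟨h1, h2, h3⟩; exact ⟨⟨h3, h1.2⟩, h2⟩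
    · rintro ⟨⟨h1, h2⟩, h3⟩
      have := mem_range.1 (h h3)
      exact ⟨⟨by omega, h2⟩, h3, h1⟩

theorem gapCount_betaSetOf {L : ℕ} {p : Finset ℕ × Finset ℕ} (h : p.2 ⊆ range L) :
    gapCount (betaSetOf L p) = hookCount p := by
  have := betaProd_betaSetOf (fun _ => 2) h
  rw [betaProd_const, hookProd_const] at this
  exact Nat.pow_right_injective le_rfl this

/-- The Maya diagrams of charge `c` with `n` hooks. -/
def mayaDiagrams (c : ℤ) (n : ℕ) : Finset (Finset ℕ × Finset ℕ) :=
  ((range (c.natAbs ^ 2 + 2 * n)).powerset ×ˢ (range (c.natAbs ^ 2 + 2 * n)).powerset).filter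
    fun p => charge p = c ∧ hookCount p = n

theorem subset_range_energy (p : Finset ℕ × Finset ℕ) :
    p.1 ⊆ range (energy p) ∧ p.2 ⊆ range (energy p) := by
  constructor
  · intro a ha
    have := single_le_sum (f := fun x => 2 * x + 1) (fun _ _ => Nat.zero_le _) ha
    rw [mem_range, energy]; omega
  · intro a ha
    have := single_le_sum (f := fun x => 2 * x + 1) (fun _ _ => Nat.zero_le _) ha
    rw [mem_range, energy]; omega

theorem energy_eq_natAbs (p : Finset ℕ × Finset ℕ) :
    energy p = (charge p).natAbs ^ 2 + 2 * hookCount p := by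
  have := energy_eq p
  zify; rw [this, sq_abs]

theorem mem_mayaDiagrams {c : ℤ} {n : ℕ} {p : Finset ℕ × Finset ℕ} :
    p ∈ mayaDiagrams c n ↔ charge p = c ∧ hookCount p = n := by
  simp only [mayaDiagrams, mem_filter, mem_product, mem_powerset, and_iff_right_iff_imp]
  rintro ⟨rfl, rfl⟩
  rw [← energy_eq_natAbs]
  exact subset_range_energy p

theorem sum_mayaDiagrams {M : Type*} [AddCommMonoid M] (c : ℤ) (n : ℕ) {k : ℕ}
    (hk : (c.natAbs ^ 2 + 2 * n : ℕ) + c ≤ k) {f : Finset ℕ × Finset ℕ → M} {g : Finset ℕ → M}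
    (hfg : ∀ L p, p.2 ⊆ range L → f p = g (betaSetOf L p)) :
    ∑ p ∈ mayaDiagrams c n, f p = ∑ X ∈ betaSets k n, g X := by
  obtain ⟨L, hL⟩ : ∃ L : ℕ, (L : ℤ) = k - c := ⟨(k - c).toNat, Int.toNat_of_nonneg (by omega)⟩
  have hsub : ∀ p ∈ mayaDiagrams c n, p.2 ⊆ range L := fun p hp => by
    obtain ⟨rfl, rfl⟩ := mem_mayaDiagrams.1 hp
    rw [← energy_eq_natAbs] at hk
    exact (subset_range_energy p).2.trans (range_mono (by omega))
  refine sum_nbij' (betaSetOf L) (ofBetaSet L) ?_ ?_ ?_ ?_ ?_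
  · intro p hp
    have h1 := hsub p hp
    have h2 := card_betaSetOf h1
    have h3 := gapCount_betaSetOf h1
    obtain ⟨rfl, rfl⟩ := mem_mayaDiagrams.1 hp
    exact mem_betaSets_iff_gapCount.2 ⟨by omega, h3⟩
  · intro X hX
    have h1 : (ofBetaSet L X).2 ⊆ range L := fun b hb => mem_range.2 (mem_ofBetaSet_snd.1 hb).1
    have h2 := card_betaSetOf h1
    have h3 := gapCount_betaSetOf h1
    rw [betaSetOf_ofBetaSet] at h2 h3
    obtain ⟨h4, h5⟩ := mem_betaSets_iff_gapCount.1 hX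
    exact mem_mayaDiagrams.2 ⟨by omega, by omega⟩
  · intro p hp; exact ofBetaSet_betaSetOf (hsub p hp)
  · intro X _; exact betaSetOf_ofBetaSet L X
  · intro p hp; exact hfg L p (hsub p hp)

theorem card_mayaDiagrams (c : ℤ) (n : ℕ) {k : ℕ} (hk : (c.natAbs ^ 2 + 2 * n : ℕ) + c ≤ k) :
    #(mayaDiagrams c n) = #(betaSets k n) := by
  rw [card_eq_sum_ones, card_eq_sum_ones]
  exact sum_mayaDiagrams c n hk fun _ _ _ => rfl

theorem card_mayaDiagrams_eq (c : ℤ) (n : ℕ) : #(mayaDiagrams c n) = #(mayaDiagrams 0 n) := by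
  obtain ⟨k, h1, h2⟩ : ∃ k : ℕ, (c.natAbs ^ 2 + 2 * n : ℕ) + c ≤ k ∧
      ((0 : ℤ).natAbs ^ 2 + 2 * n : ℕ) + (0 : ℤ) ≤ k :=
    ⟨c.natAbs ^ 2 + 2 * n + c.natAbs, by push_cast; linarith [le_abs_self c], by
      push_cast; simp; nlinarith [abs_nonneg c, sq_nonneg c]⟩
  rw [card_mayaDiagrams c n h1, card_mayaDiagrams 0 n h2]

theorem sum_sq_hookProd (c : ℤ) (n : ℕ) :
    ∑ p ∈ mayaDiagrams c n, (hookProd (fun h : ℕ => (h : ℚ)⁻¹) p) ^ 2 = 1 / (n.factorial : ℚ) := by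
  have h1 : (c.natAbs ^ 2 + 2 * n : ℕ) + c ≤ (c.natAbs ^ 2 + 2 * n + c.natAbs + n : ℕ) := by
    push_cast; linarith [le_abs_self c]
  rw [← sum_sq_betaWeight (k := c.natAbs ^ 2 + 2 * n + c.natAbs + n) (n := n) (by omega)]
  exact sum_mayaDiagrams c n h1 fun L p h => by rw [betaWeight, betaProd_betaSetOf _ h]

/-- The ground state of charge `c`. -/
def groundState (c : ℤ) : Finset ℕ × Finset ℕ :=
  (range c.toNat, range (-c).toNat)

theorem charge_groundState (c : ℤ) : charge (groundState c) = c := by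
  simp only [charge, groundState, card_range]; omega

theorem hookCount_groundState (c : ℤ) : hookCount (groundState c) = 0 := by
  simp only [hookCount, groundState, gapCount_range, card_range, add_zero, mul_eq_zero]
  omega

theorem mayaDiagrams_zero (c : ℤ) : mayaDiagrams c 0 = {groundState c} := by
  have h := sum_sq_hookProd c 0
  have hc := card_mayaDiagrams c 0 (k := c.natAbs ^ 2 + c.natAbs) (by
    push_cast; linarith [le_abs_self c])
  rw [betaSets_zero, card_singleton, card_eq_one] at hc
  obtain ⟨p, hp⟩ := hc
  have : groundState c ∈ mayaDiagrams c 0 :=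
    mem_mayaDiagrams.2 ⟨charge_groundState c, hookCount_groundState c⟩
  rw [hp, mem_singleton] at this
  rw [hp, this]

theorem eq_groundState {p : Finset ℕ × Finset ℕ} (h : hookCount p = 0) :
    p = groundState (charge p) := by
  have : p ∈ mayaDiagrams (charge p) 0 := mem_mayaDiagrams.2 ⟨rfl, h⟩
  rwa [mayaDiagrams_zero, mem_singleton] at this

end

section

open Finset Filter Topology

/-- The number of partitions of `n`. -/
def partitionNumber (n : ℕ) : ℕ :=
  #(mayaDiagrams 0 n)

theorem card_betaSets_of_le {k n : ℕ} (h : 2 * n ≤ k) : #(betaSets k n) = partitionNumber n :=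
  (card_mayaDiagrams 0 n (by simpa using mod_cast h)).symm

theorem card_betaSets_le (k n : ℕ) : #(betaSets k n) ≤ partitionNumber n := by
  have hm : Monotone fun k => #(betaSets k n) := monotone_nat_of_le_succ fun k => by
    rw [card_betaSets_succ]; exact Nat.le_add_right _ _
  rw [← card_betaSets_of_le (le_max_right k (2 * n))]
  exact hm (le_max_left _ _)

/-- The weight `z ^ charge * Q ^ energy` of a Maya diagram. -/
noncomputable def mayaWeight (z Q : ℂ) (p : Finset ℕ × Finset ℕ) : ℂ :=
  z ^ charge p * Q ^ energy p

theorem mayaWeight_eq_prod {z : ℂ} (hz : z ≠ 0) (Q : ℂ) (p : Finset ℕ × Finset ℕ) :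
    mayaWeight z Q p =
      (∏ a ∈ p.1, z * Q ^ (2 * a + 1)) * ∏ b ∈ p.2, z⁻¹ * Q ^ (2 * b + 1) := by
  rw [mayaWeight, charge, energy, prod_mul_distrib, prod_mul_distrib, prod_const, prod_const,
    prod_pow_eq_pow_sum, prod_pow_eq_pow_sum, zpow_sub₀ hz, pow_add, zpow_natCast, zpow_natCast,
    inv_pow]
  field_simp

theorem summable_norm_odd_powers (z : ℂ) {Q : ℂ} (hQ : ‖Q‖ < 1) :
    Summable fun m : ℕ => ‖z * Q ^ (2 * m + 1)‖ := by
  have h : ‖Q‖ ^ 2 < 1 := pow_lt_one₀ (norm_nonneg _) hQ two_ne_zero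
  have := (summable_geometric_of_lt_one (by positivity) h).mul_left (‖z‖ * ‖Q‖)
  refine this.congr fun m => ?_
  rw [norm_mul, norm_pow, pow_succ _ (2 * m), pow_mul]; ring

theorem summable_norm_prod_odd_powers (z : ℂ) {Q : ℂ} (hQ : ‖Q‖ < 1) :
    Summable fun A : Finset ℕ => ‖∏ a ∈ A, z * Q ^ (2 * a + 1)‖ := by
  have := summable_finsetProd_of_summable_norm (f := fun m : ℕ => ‖z * Q ^ (2 * m + 1)‖)
    (by simpa using summable_norm_odd_powers z hQ)
  simpa only [norm_prod] using this

theorem summable_norm_mayaWeight {z Q : ℂ} (hz : z ≠ 0) (hQ : ‖Q‖ < 1) :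
    Summable fun p => ‖mayaWeight z Q p‖ := by
  have := (summable_norm_prod_odd_powers z hQ).mul_of_nonneg
    (summable_norm_prod_odd_powers z⁻¹ hQ) (fun _ => norm_nonneg _) (fun _ => norm_nonneg _)
  refine this.congr fun p => ?_
  rw [mayaWeight_eq_prod hz, norm_mul]

theorem tsum_mayaWeight_eq_tprod {z Q : ℂ} (hz : z ≠ 0) (hQ : ‖Q‖ < 1) :
    ∑' p, mayaWeight z Q p =
      (∏' m : ℕ, (1 + z * Q ^ (2 * m + 1))) * ∏' m : ℕ, (1 + z⁻¹ * Q ^ (2 * m + 1)) := by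
  rw [tprod_one_add (summable_norm_prod_odd_powers z hQ).of_norm,
    tprod_one_add (summable_norm_prod_odd_powers z⁻¹ hQ).of_norm,
    tsum_mul_tsum_of_summable_norm (summable_norm_prod_odd_powers z hQ)
      (summable_norm_prod_odd_powers z⁻¹ hQ)]
  exact tsum_congr fun p => mayaWeight_eq_prod hz Q p

/-- Maya diagrams sorted by charge and number of hooks. -/
def mayaEquiv : (Σ k : ℤ × ℕ, mayaDiagrams k.1 k.2) ≃ Finset ℕ × Finset ℕ where
  toFun x := x.2
  invFun p := ⟨(charge p, hookCount p), p, mem_mayaDiagrams.2 ⟨rfl, rfl⟩⟩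
  left_inv := by
    rintro ⟨⟨c, n⟩, p, hp⟩
    obtain ⟨rfl, rfl⟩ := mem_mayaDiagrams.1 hp
    rfl
  right_inv _ := rfl

theorem summable_maya_iff {F : Finset ℕ × Finset ℕ → ℝ} (hF : ∀ p, 0 ≤ F p) :
    Summable F ↔ Summable fun k : ℤ × ℕ => ∑ p ∈ mayaDiagrams k.1 k.2, F p := by
  rw [← mayaEquiv.summable_iff, summable_sigma_of_nonneg (f := F ∘ mayaEquiv) fun x => hF _]
  have : ∀ k : ℤ × ℕ, ∑' y : mayaDiagrams k.1 k.2, (F ∘ mayaEquiv) ⟨k, y⟩ =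
      ∑ p ∈ mayaDiagrams k.1 k.2, F p := fun k => by
    rw [tsum_fintype]; exact sum_coe_sort (mayaDiagrams k.1 k.2) F
  simp only [this]
  exact and_iff_right fun k => (hasSum_fintype _).summable

theorem tsum_maya {F : Finset ℕ × Finset ℕ → ℂ} (hF : Summable fun p => ‖F p‖) :
    ∑' p, F p = ∑' k : ℤ × ℕ, ∑ p ∈ mayaDiagrams k.1 k.2, F p := by
  have hs : Summable (F ∘ mayaEquiv) := mayaEquiv.summable_iff.2 hF.of_norm
  rw [← mayaEquiv.tsum_eq]
  refine hs.tsum_sigma.trans ?_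
  refine tsum_congr fun k => ?_
  rw [tsum_fintype]; exact sum_coe_sort (mayaDiagrams k.1 k.2) F

theorem mayaWeight_of_mem {z Q : ℂ} {c : ℤ} {n : ℕ} {p : Finset ℕ × Finset ℕ}
    (h : p ∈ mayaDiagrams c n) : mayaWeight z Q p = z ^ c * Q ^ c.natAbs ^ 2 * (Q ^ 2) ^ n := by
  obtain ⟨rfl, rfl⟩ := mem_mayaDiagrams.1 h
  rw [mayaWeight, energy_eq_natAbs, pow_add, pow_mul, mul_assoc]

theorem summable_norm_theta {z Q : ℂ} (hz : z ≠ 0) (hQ : ‖Q‖ < 1) :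
    Summable fun c : ℤ => ‖z ^ c * Q ^ c.natAbs ^ 2‖ := by
  have hinj : Function.Injective groundState := fun a b h => by
    rw [← charge_groundState a, h, charge_groundState]
  refine ((summable_norm_mayaWeight hz hQ).comp_injective hinj).congr fun c => ?_
  have : groundState c ∈ mayaDiagrams c 0 := by rw [mayaDiagrams_zero]; exact mem_singleton_self _
  simp [mayaWeight_of_mem this]

theorem summable_norm_partitionNumber {y : ℂ} (hy : ‖y‖ < 1) :
    Summable fun n => ‖(partitionNumber n : ℂ) * y ^ n‖ := by
  obtain ⟨Q, rfl⟩ := IsAlgClosed.exists_pow_nat_eq y two_pos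
  have hQ : ‖Q‖ < 1 := by
    rw [norm_pow] at hy
    exact lt_of_not_ge fun h => (not_le.2 hy) (one_le_pow₀ h)
  have h := (summable_maya_iff fun p => norm_nonneg _).1
    (summable_norm_mayaWeight one_ne_zero hQ)
  have hinj : Function.Injective fun n : ℕ => ((0 : ℤ), n) := fun a b h => by simpa using h
  refine (h.comp_injective hinj).congr fun n => ?_
  dsimp only [Function.comp_apply]
  rw [sum_congr rfl fun p hp => by rw [mayaWeight_of_mem hp], sum_const, partitionNumber]
  simp

theorem prod_mul_tsum_card_betaSets {y : ℂ} (hy : ‖y‖ < 1) (k : ℕ) :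
    (∏ m ∈ range k, (1 - y ^ (m + 1))) * ∑' n, (#(betaSets k n) : ℂ) * y ^ n = 1 := by
  have hs : ∀ k, Summable fun n => (#(betaSets k n) : ℂ) * y ^ n := fun k => by
    refine Summable.of_norm_bounded (summable_norm_partitionNumber hy) fun n => ?_
    rw [norm_mul, norm_mul]
    gcongr
    rw [Complex.norm_natCast, Complex.norm_natCast]
    exact_mod_cast card_betaSets_le k n
  induction k with
  | zero =>
    rw [tsum_eq_single 0]
    · simp [betaSets_zero]
    · intro n hn
      have : betaSets 0 n = ∅ := by
        ext X
        simp only [mem_betaSets, card_eq_zero, notMem_empty, iff_false, not_and]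
        rintro rfl; simp; omega
      simp [this]
  | succ k ih =>
    have h1 : ∑' n, (#(betaSets (k + 1) n) : ℂ) * y ^ n = ∑' n, (#(betaSets k n) : ℂ) * y ^ n +
        y ^ (k + 1) * ∑' n, (#(betaSets (k + 1) n) : ℂ) * y ^ n := by
      have h2 : HasSum (fun n => if k + 1 ≤ n then
          (#(betaSets (k + 1) (n - (k + 1))) : ℂ) * y ^ n else 0)
          (y ^ (k + 1) * ∑' n, (#(betaSets (k + 1) n) : ℂ) * y ^ n) := by
        rw [← hasSum_nat_add_iff' (k + 1), sum_eq_zero, sub_zero]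
        · refine ((hs (k + 1)).hasSum.mul_left (y ^ (k + 1))).congr_fun fun n => ?_
          rw [if_pos (by omega), Nat.add_sub_cancel, pow_add]; ring
        · intro n hn; rw [if_neg]; have := mem_range.1 hn; omega
      refine HasSum.tsum_eq (((hs k).hasSum.add h2).congr_fun fun n => ?_)
      rw [card_betaSets_succ]
      split_ifs <;> push_cast <;> ring
    rw [prod_range_succ]
    linear_combination ih + (∏ m ∈ range k, (1 - y ^ (m + 1))) * h1

/-- Euler's generating function of the partition numbers. -/
theorem tprod_mul_tsum_partitionNumber {y : ℂ} (hy : ‖y‖ < 1) :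
    (∏' m : ℕ, (1 - y ^ (m + 1))) * ∑' n, (partitionNumber n : ℂ) * y ^ n = 1 := by
  have hm : Multipliable fun m : ℕ => 1 - y ^ (m + 1) := by
    have := multipliable_qPochhammerInf y hy
    refine this.congr fun m => ?_
    rw [pow_succ']
  have h1 := hm.hasProd.tendsto_prod_nat
  have h2 : Tendsto (fun k => ∑' n, (#(betaSets k n) : ℂ) * y ^ n) atTop
      (𝓝 (∑' n, (partitionNumber n : ℂ) * y ^ n)) := by
    refine tendsto_tsum_of_dominated_convergence (summable_norm_partitionNumber hy) ?_ ?_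
    · intro n
      refine tendsto_const_nhds.congr' ?_
      filter_upwards [eventually_ge_atTop (2 * n)] with k hk
      rw [card_betaSets_of_le hk]
    · refine Eventually.of_forall fun k n => ?_
      rw [norm_mul, norm_mul]
      gcongr
      rw [Complex.norm_natCast, Complex.norm_natCast]
      exact_mod_cast card_betaSets_le k n
  refine tendsto_nhds_unique (h1.mul h2) ?_
  simp only [prod_mul_tsum_card_betaSets hy]
  exact tendsto_const_nhds

theorem hasSum_mayaWeight_mul {z Q : ℂ} (hz : z ≠ 0) (hQ : ‖Q‖ < 1)
    {g : Finset ℕ × Finset ℕ → ℂ} {s : ℕ → ℂ}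
    (hg : ∀ c n, ∑ p ∈ mayaDiagrams c n, g p = s n)
    {s' : ℕ → ℝ} (hg' : ∀ c n, ∑ p ∈ mayaDiagrams c n, ‖g p‖ = s' n)
    (hs' : Summable fun n => ‖(Q ^ 2) ^ n‖ * s' n) :
    (Summable fun p => ‖mayaWeight z Q p * g p‖) ∧
      ∑' p, mayaWeight z Q p * g p =
        (∑' c : ℤ, z ^ c * Q ^ c.natAbs ^ 2) * ∑' n, (Q ^ 2) ^ n * s n := by
  have h0 : ∀ n, 0 ≤ s' n := fun n => by
    rw [← hg' 0 n]; exact sum_nonneg fun p _ => norm_nonneg _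
  have hsum : Summable fun p => ‖mayaWeight z Q p * g p‖ := by
    rw [summable_maya_iff fun p => norm_nonneg _]
    refine ((summable_norm_theta hz hQ).mul_of_nonneg hs' (fun _ => norm_nonneg _)
      fun n => mul_nonneg (norm_nonneg _) (h0 n)).congr fun k => ?_
    rw [← hg' k.1 k.2, ← mul_assoc, mul_sum]
    refine sum_congr rfl fun p hp => ?_
    rw [mayaWeight_of_mem hp, norm_mul, norm_mul, norm_mul, norm_mul]
  refine ⟨hsum, ?_⟩
  have hs : Summable fun n => ‖(Q ^ 2) ^ n * s n‖ := by
    refine hs'.of_nonneg_of_le (fun _ => norm_nonneg _) fun n => ?_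
    rw [norm_mul, ← hg 0 n, ← hg' 0 n]
    gcongr
    exact norm_sum_le _ _
  rw [tsum_maya hsum, tsum_mul_tsum_of_summable_norm (summable_norm_theta hz hQ) hs]
  refine tsum_congr fun k => ?_
  rw [← hg k.1 k.2, ← mul_assoc, mul_sum]
  exact sum_congr rfl fun p hp => by rw [mayaWeight_of_mem hp]

/-- A form of Jacobi's triple product identity. -/
theorem tsum_theta_eq {z Q : ℂ} (hz : z ≠ 0) (hQ : ‖Q‖ < 1) :
    ∑' c : ℤ, z ^ c * Q ^ c.natAbs ^ 2 =
      (∏' m : ℕ, (1 - (Q ^ 2) ^ (m + 1))) * ∑' p, mayaWeight z Q p := by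
  have hy : ‖Q ^ 2‖ < 1 := by rw [norm_pow]; exact pow_lt_one₀ (norm_nonneg _) hQ two_ne_zero
  have h := hasSum_mayaWeight_mul hz hQ (g := fun _ => 1) (s := fun n => partitionNumber n)
    (s' := fun n => partitionNumber n) (by simp [card_mayaDiagrams_eq, partitionNumber])
    (by simp [card_mayaDiagrams_eq, partitionNumber])
    ((summable_norm_partitionNumber hy).congr fun n => by simp [mul_comm])
  simp only [mul_one] at h
  have h2 := tprod_mul_tsum_partitionNumber hy
  simp only [mul_comm _ ((Q ^ 2) ^ _)] at h2
  rw [h.2]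
  linear_combination -(∑' c : ℤ, z ^ c * Q ^ c.natAbs ^ 2) * h2

theorem hasSum_mayaWeight_hookProd {z Q : ℂ} (hz : z ≠ 0) (hQ : ‖Q‖ < 1) (x : ℂ) :
    (Summable fun p => ‖mayaWeight z Q p * hookProd (fun h : ℕ => x / h) p ^ 2‖) ∧
      ∑' p, mayaWeight z Q p * hookProd (fun h : ℕ => x / h) p ^ 2 =
        (∏' m : ℕ, (1 - (Q ^ 2) ^ (m + 1))) * Complex.exp (Q ^ 2 * x ^ 2) *
          ∑' p, mayaWeight z Q p := by
  have e : ∀ p, hookProd (fun h : ℕ => x / h) p ^ 2 =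
      (x ^ 2) ^ hookCount p * (((hookProd (fun h : ℕ => (h : ℚ)⁻¹) p) ^ 2 : ℚ) : ℂ) := fun p => by
    have := map_hookProd (Rat.castHom ℂ : ℚ →* ℂ) (fun h : ℕ => (h : ℚ)⁻¹) p
    simp only [MonoidHom.coe_coe, Rat.coe_castHom, Rat.cast_inv, Rat.cast_natCast] at this
    simp only [div_eq_mul_inv, hookProd_mul, hookProd_const, mul_pow, Rat.cast_pow, this]
    rw [← pow_mul, ← pow_mul, mul_comm 2]
  have h := hasSum_mayaWeight_mul hz hQ (g := fun p => hookProd (fun h : ℕ => x / h) p ^ 2)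
    (s := fun n => (x ^ 2) ^ n / n.factorial) (s' := fun n => (‖x‖ ^ 2) ^ n / n.factorial)
    (fun c n => by
      have h1 := congrArg (Rat.cast : ℚ → ℂ) (sum_sq_hookProd c n)
      push_cast at h1
      rw [div_eq_mul_one_div, ← h1, mul_sum]
      refine sum_congr rfl fun p hp => ?_
      rw [e, (mem_mayaDiagrams.1 hp).2, Rat.cast_pow])
    (fun c n => by
      have h1 := congrArg (Rat.cast : ℚ → ℝ) (sum_sq_hookProd c n)
      push_cast at h1
      rw [div_eq_mul_one_div, ← h1, mul_sum]
      refine sum_congr rfl fun p hp => ?_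
      rw [e, (mem_mayaDiagrams.1 hp).2, norm_mul, norm_pow, norm_pow, Rat.cast_pow, norm_pow,
        ← Complex.ofReal_ratCast, Complex.norm_real, Real.norm_eq_abs, sq_abs])
    ((Real.summable_pow_div_factorial (‖Q ^ 2‖ * ‖x‖ ^ 2)).congr fun n => by
      rw [mul_pow, norm_pow (Q ^ 2) n, mul_div_assoc])
  refine ⟨h.1, ?_⟩
  rw [h.2, tsum_theta_eq hz hQ, Complex.exp_eq_exp_ℂ, NormedSpace.exp_eq_tsum_div]
  simp only [mul_pow, mul_div_assoc]
  ring

end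

section

open Finset

theorem mul_add_inj {t a b i j : ℕ} (hi : i < t) (hj : j < t) (h : t * a + i = t * b + j) :
    a = b ∧ i = j := by
  have ha : (t * a + i) / t = a := by
    rw [Nat.mul_add_div (by omega), Nat.div_eq_of_lt hi, add_zero]
  have hb : (t * b + j) / t = b := by
    rw [Nat.mul_add_div (by omega), Nat.div_eq_of_lt hj, add_zero]
  have : a = b := by rw [← ha, h, hb]
  subst this
  exact ⟨rfl, by omega⟩

theorem injOn_mul_add {t i : ℕ} (hi : i < t) (s : Set ℕ) : Set.InjOn (fun a => t * a + i) s :=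
  fun _ _ _ _ h => (mul_add_inj hi hi h).1

/-- The set of natural numbers that consists, for each `r < τ`, of the numbers `2 τ a + r` with
`a ∈ (p r).1` and of the numbers `2 τ b + (2 τ - 1 - r)` with `b ∈ (p r).2`. -/
def mergeResidues (τ : ℕ) (p : Fin τ → Finset ℕ × Finset ℕ) : Finset ℕ :=
  univ.biUnion fun r : Fin τ => (p r).1.image (fun a => 2 * τ * a + r) ∪
    (p r).2.image (fun b => 2 * τ * b + (2 * τ - 1 - r))

/-- The inverse of `mergeResidues`. -/
noncomputable def splitResidues (τ : ℕ) (D : Finset ℕ) (r : Fin τ) : Finset ℕ × Finset ℕ :=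
  (D.preimage (fun a => 2 * τ * a + r) (injOn_mul_add (by omega) _),
    D.preimage (fun b => 2 * τ * b + (2 * τ - 1 - r)) (injOn_mul_add (by omega) _))

theorem mem_splitResidues_fst {τ : ℕ} {D : Finset ℕ} {r : Fin τ} {a : ℕ} :
    a ∈ (splitResidues τ D r).1 ↔ 2 * τ * a + r ∈ D := by
  exact mem_preimage (hf := injOn_mul_add (by omega) _)

theorem mem_splitResidues_snd {τ : ℕ} {D : Finset ℕ} {r : Fin τ} {b : ℕ} :
    b ∈ (splitResidues τ D r).2 ↔ 2 * τ * b + (2 * τ - 1 - r) ∈ D := by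
  exact mem_preimage (hf := injOn_mul_add (by omega) _)

theorem mem_mergeResidues_left {τ : ℕ} {p : Fin τ → Finset ℕ × Finset ℕ} {r : Fin τ} {a : ℕ} :
    2 * τ * a + r ∈ mergeResidues τ p ↔ a ∈ (p r).1 := by
  simp only [mergeResidues, mem_biUnion, mem_univ, true_and, mem_union, mem_image]
  constructor
  · rintro ⟨s, ⟨b, hb, h⟩ | ⟨b, hb, h⟩⟩
    · obtain ⟨rfl, h⟩ := mul_add_inj (by omega) (by omega) h
      have : s = r := Fin.ext (by omega)
      rwa [← this]
    · have := (mul_add_inj (by omega) (by omega) h).2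
      omega
  · intro h; exact ⟨r, Or.inl ⟨a, h, rfl⟩⟩

theorem mem_mergeResidues_right {τ : ℕ} {p : Fin τ → Finset ℕ × Finset ℕ} {r : Fin τ} {b : ℕ} :
    2 * τ * b + (2 * τ - 1 - r) ∈ mergeResidues τ p ↔ b ∈ (p r).2 := by
  simp only [mergeResidues, mem_biUnion, mem_univ, true_and, mem_union, mem_image]
  constructor
  · rintro ⟨s, ⟨c, hc, h⟩ | ⟨c, hc, h⟩⟩
    · have := (mul_add_inj (by omega) (by omega) h).2
      omega
    · obtain ⟨rfl, h⟩ := mul_add_inj (by omega) (by omega) h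
      have : s = r := Fin.ext (by omega)
      rwa [← this]
  · intro h; exact ⟨r, Or.inr ⟨b, h, rfl⟩⟩

theorem exists_residue {τ : ℕ} (hτ : 0 < τ) (d : ℕ) :
    ∃ (r : Fin τ) (a : ℕ), d = 2 * τ * a + r ∨ d = 2 * τ * a + (2 * τ - 1 - r) := by
  have h1 := Nat.div_add_mod d (2 * τ)
  have h2 := Nat.mod_lt d (show 0 < 2 * τ by omega)
  rcases lt_or_ge (d % (2 * τ)) τ with h | h
  · exact ⟨⟨d % (2 * τ), h⟩, d / (2 * τ), Or.inl h1.symm⟩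
  · refine ⟨⟨2 * τ - 1 - d % (2 * τ), by omega⟩, d / (2 * τ), Or.inr ?_⟩
    dsimp only
    rw [show 2 * τ - 1 - (2 * τ - 1 - d % (2 * τ)) = d % (2 * τ) by omega]
    exact h1.symm

/-- The decomposition of a finite set of natural numbers by residues modulo `2 τ`. -/
noncomputable def residueEquiv (τ : ℕ) (hτ : 0 < τ) :
    Finset ℕ ≃ (Fin τ → Finset ℕ × Finset ℕ) where
  toFun := splitResidues τ
  invFun := mergeResidues τ
  left_inv D := by
    ext d
    obtain ⟨r, a, rfl | rfl⟩ := exists_residue hτ d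
    · rw [mem_mergeResidues_left, mem_splitResidues_fst]
    · rw [mem_mergeResidues_right, mem_splitResidues_snd]
  right_inv p := by
    funext r
    refine Prod.ext ?_ ?_
    · ext a; rw [← mem_mergeResidues_left (p := p), mem_splitResidues_fst]
    · ext a; rw [← mem_mergeResidues_right (p := p), mem_splitResidues_snd]

@[to_additive]
theorem prod_mergeResidues {M : Type*} [CommMonoid M] (τ : ℕ) (p : Fin τ → Finset ℕ × Finset ℕ)
    (g : ℕ → M) : ∏ d ∈ mergeResidues τ p, g d =
      ∏ r : Fin τ, (∏ a ∈ (p r).1, g (2 * τ * a + r)) *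
        ∏ b ∈ (p r).2, g (2 * τ * b + (2 * τ - 1 - r)) := by
  rw [mergeResidues, prod_biUnion]
  · refine prod_congr rfl fun r _ => ?_
    rw [prod_union, prod_image, prod_image]
    · exact fun _ _ _ _ h => (mul_add_inj (by omega) (by omega) h).1
    · exact fun _ _ _ _ h => (mul_add_inj (by omega) (by omega) h).1
    · rw [disjoint_left]
      intro x hx hx'
      obtain ⟨a, -, rfl⟩ := mem_image.1 hx
      obtain ⟨b, -, h⟩ := mem_image.1 hx'
      have := (mul_add_inj (by omega) (by omega) h).2
      omega
  · intro r _ s _ hrs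
    rw [Function.onFun, disjoint_left]
    intro x hx hx'
    simp only [mem_union, mem_image] at hx hx'
    refine hrs (Fin.ext ?_)
    rcases hx with ⟨a, -, rfl⟩ | ⟨a, -, rfl⟩ <;> rcases hx' with ⟨b, -, h⟩ | ⟨b, -, h⟩ <;>
    · have := (mul_add_inj (by omega) (by omega) h).2
      omega

theorem prod_range_sdiff_residue {M : Type*} [CommMonoid M] {t i : ℕ} (hi : i < t) {φ : ℕ → M}
    (hφ : ∀ h, ¬ t ∣ h → φ h = 1) {D A : Finset ℕ} (hA : ∀ n, t * n + i ∈ D ↔ n ∈ A) (a : ℕ) :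
    ∏ m ∈ range (t * a + i) \ D, φ (t * a + i - m) = ∏ n ∈ range a \ A, φ (t * (a - n)) := by
  have hinj : Set.InjOn (fun n => t * n + i) (range a \ A : Finset ℕ) :=
    fun _ _ _ _ h => (mul_add_inj hi hi h).1
  have e : ∏ n ∈ range a \ A, φ (t * (a - n)) =
      ∏ m ∈ (range a \ A).image (fun n => t * n + i), φ (t * a + i - m) := by
    rw [prod_image hinj]
    refine prod_congr rfl fun n hn => congrArg φ ?_
    rw [Nat.mul_sub]; omega
  rw [e]
  symm
  refine prod_subset ?_ ?_
  · intro m hm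
    simp only [mem_image, mem_sdiff, mem_range] at hm ⊢
    obtain ⟨n, ⟨hn, hn'⟩, rfl⟩ := hm
    have := Nat.mul_lt_mul_of_pos_left hn (show 0 < t by omega)
    exact ⟨by omega, by rwa [hA]⟩
  · intro m hm hm'
    refine hφ _ fun hd => hm' ?_
    simp only [mem_image, mem_sdiff, mem_range] at hm ⊢
    obtain ⟨k, hk⟩ := hd
    have hka : k ≤ a := by
      by_contra hlt
      have := Nat.mul_le_mul_left t (show a + 1 ≤ k by omega)
      rw [mul_add] at this
      omega
    have hk0 : k ≠ 0 := by rintro rfl; omega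
    have hm0 : t * (a - k) + i = m := by
      rw [Nat.mul_sub]
      have := Nat.mul_le_mul_left t hka
      omega
    exact ⟨a - k, ⟨by omega, by rw [← hA, hm0]; exact hm.2⟩, hm0⟩

theorem betaProd_mergeResidues {M : Type*} [CommMonoid M] (τ : ℕ) {φ : ℕ → M}
    (hφ : ∀ h, ¬ 2 * τ ∣ h → φ h = 1) (p : Fin τ → Finset ℕ × Finset ℕ) :
    betaProd φ (mergeResidues τ p) =
      ∏ r, betaProd (fun h => φ (2 * τ * h)) (p r).1 * betaProd (fun h => φ (2 * τ * h)) (p r).2 := by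
  rw [betaProd, prod_mergeResidues]
  refine prod_congr rfl fun r _ => ?_
  congr 1
  · refine prod_congr rfl fun a _ => ?_
    exact prod_range_sdiff_residue (by omega) hφ (fun n => mem_mergeResidues_left) a
  · refine prod_congr rfl fun a _ => ?_
    exact prod_range_sdiff_residue (by omega) hφ (fun n => mem_mergeResidues_right) a

theorem not_dvd_of_mod {t n k : ℕ} (h0 : 0 < k) (hk : k < t) : ¬ t ∣ t * n + k := by
  rw [Nat.dvd_add_right (Nat.dvd_mul_right t n)]
  exact Nat.not_dvd_of_pos_of_lt h0 hk

theorem hookProd_mergeResidues {M : Type*} [CommMonoid M] (τ : ℕ) {φ : ℕ → M}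
    (hφ : ∀ h, ¬ 2 * τ ∣ h → φ h = 1) (p : Fin τ → Finset ℕ × Finset ℕ) :
    hookProd φ (mergeResidues τ p, mergeResidues τ p) =
      ∏ r, hookProd (fun h => φ (2 * τ * h)) (p r) ^ 2 := by
  have h1 : ∀ (r : Fin τ) (a : ℕ), ∏ d ∈ mergeResidues τ p, φ (2 * τ * a + r + d + 1) =
      ∏ b ∈ (p r).2, φ (2 * τ * (a + b + 1)) := fun r a => by
    rw [prod_mergeResidues, Fintype.prod_eq_single r]
    · rw [prod_eq_one, one_mul]
      · refine prod_congr rfl fun b _ => congrArg φ ?_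
        rw [mul_add, mul_add]; omega
      · intro b _
        rw [show 2 * τ * a + r + (2 * τ * b + r) + 1 = 2 * τ * (a + b) + (r + r + 1) by ring]
        exact hφ _ (not_dvd_of_mod (by omega) (by omega))
    · intro s hs
      have hs' : (s : ℕ) ≠ r := fun h => hs (Fin.ext h)
      rw [prod_eq_one, prod_eq_one, one_mul]
      · intro b _
        rcases lt_or_gt_of_ne hs' with h | h
        · rw [show 2 * τ * a + r + (2 * τ * b + (2 * τ - 1 - s)) + 1 =
            2 * τ * (a + b + 1) + (r - s) by rw [mul_add, mul_add]; omega]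
          exact hφ _ (not_dvd_of_mod (by omega) (by omega))
        · rw [show 2 * τ * a + r + (2 * τ * b + (2 * τ - 1 - s)) + 1 =
            2 * τ * (a + b) + (2 * τ - (s - r)) by rw [mul_add]; omega]
          exact hφ _ (not_dvd_of_mod (by omega) (by omega))
      · intro b _
        rw [show 2 * τ * a + r + (2 * τ * b + s) + 1 = 2 * τ * (a + b) + (r + s + 1) by ring]
        exact hφ _ (not_dvd_of_mod (by omega) (by omega))
  have h2 : ∀ (r : Fin τ) (b : ℕ),
      ∏ d ∈ mergeResidues τ p, φ (2 * τ * b + (2 * τ - 1 - r) + d + 1) =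
      ∏ a ∈ (p r).1, φ (2 * τ * (a + b + 1)) := fun r a => by
    rw [prod_mergeResidues, Fintype.prod_eq_single r]
    · rw [mul_comm, prod_eq_one, one_mul]
      · refine prod_congr rfl fun b _ => congrArg φ ?_
        rw [mul_add, mul_add]; omega
      · intro b _
        rw [show 2 * τ * a + (2 * τ - 1 - r) + (2 * τ * b + (2 * τ - 1 - r)) + 1 =
          2 * τ * (a + b + 1) + (2 * τ - 1 - r - r) by rw [mul_add, mul_add]; omega]
        exact hφ _ (not_dvd_of_mod (by omega) (by omega))
    · intro s hs
      have hs' : (s : ℕ) ≠ r := fun h => hs (Fin.ext h)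
      rw [prod_eq_one, prod_eq_one, one_mul]
      · intro b _
        rw [show 2 * τ * a + (2 * τ - 1 - r) + (2 * τ * b + (2 * τ - 1 - s)) + 1 =
          2 * τ * (a + b + 1) + (2 * τ - 1 - r - s) by rw [mul_add, mul_add]; omega]
        exact hφ _ (not_dvd_of_mod (by omega) (by omega))
      · intro b _
        rcases lt_or_gt_of_ne hs' with h | h
        · rw [show 2 * τ * a + (2 * τ - 1 - r) + (2 * τ * b + s) + 1 =
            2 * τ * (a + b) + (2 * τ - (r - s)) by rw [mul_add]; omega]
          exact hφ _ (not_dvd_of_mod (by omega) (by omega))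
        · rw [show 2 * τ * a + (2 * τ - 1 - r) + (2 * τ * b + s) + 1 =
            2 * τ * (a + b + 1) + (s - r) by rw [mul_add, mul_add]; omega]
          exact hφ _ (not_dvd_of_mod (by omega) (by omega))
  rw [hookProd]
  dsimp only
  rw [betaProd_mergeResidues τ hφ, prod_mergeResidues, ← prod_mul_distrib, ← prod_mul_distrib]
  refine prod_congr rfl fun r _ => ?_
  rw [prod_congr rfl fun a _ => h1 r a, prod_congr rfl fun b _ => h2 r b, hookProd,
    prod_comm (s := (p r).2), sq]
  ac_rfl

theorem sum_two_mul_add_one_mergeResidues (τ : ℕ) (p : Fin τ → Finset ℕ × Finset ℕ) :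
    ∑ d ∈ mergeResidues τ p, (2 * (d : ℤ) + 1) =
      ∑ r : Fin τ, (2 * τ * (energy (p r) : ℤ) + (2 * r + 1 - 2 * τ) * charge (p r)) := by
  rw [sum_mergeResidues]
  refine sum_congr rfl fun r _ => ?_
  have h1 : ∀ b : ℕ, ((2 * τ * b + (2 * τ - 1 - r) : ℕ) : ℤ) = 2 * τ * b + (2 * τ - 1 - r) :=
    fun b => by
      have : ((2 * τ - 1 - r : ℕ) : ℤ) = 2 * τ - 1 - r := by omega
      rw [Nat.cast_add, this]; push_cast; rfl
  simp only [h1, energy, charge]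
  push_cast
  simp only [mul_add, sum_add_distrib, ← mul_sum, sum_const, nsmul_eq_mul]
  ring

theorem sum_neg_one_pow_mergeResidues (τ : ℕ) (p : Fin τ → Finset ℕ × Finset ℕ) :
    ∑ d ∈ mergeResidues τ p, (-1 : ℤ) ^ d = ∑ r : Fin τ, (-1) ^ (r : ℕ) * charge (p r) := by
  rw [sum_mergeResidues]
  refine sum_congr rfl fun r _ => ?_
  have h1 : (-1 : ℤ) ^ (2 * τ - 1 - (r : ℕ)) = - (-1) ^ (r : ℕ) := by
    have h : (-1 : ℤ) ^ (2 * τ - 1 - (r : ℕ)) * (-1) ^ (r : ℕ) = -1 := by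
      rw [← pow_add, show 2 * τ - 1 - (r : ℕ) + r = 2 * (τ - 1) + 1 by omega, pow_succ, pow_mul]
      simp
    rcases neg_one_pow_eq_or ℤ (r : ℕ) with h' | h' <;> rw [h'] at h ⊢ <;> linarith
  simp only [pow_add, pow_mul, h1, charge]
  simp
  ring

theorem summable_and_tsum_pi {α : Type*} : ∀ {n : ℕ} {f : Fin n → α → ℂ}
    (_ : ∀ i, Summable fun a => ‖f i a‖),
    (Summable fun x : Fin n → α => ‖∏ i, f i (x i)‖) ∧
      ∑' x : Fin n → α, ∏ i, f i (x i) = ∏ i, ∑' a, f i a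
  | 0, f, _ => ⟨(hasSum_fintype _).summable, by simp⟩
  | n + 1, f, hf => by
    obtain ⟨h1, h2⟩ := summable_and_tsum_pi (fun i : Fin n => hf i.succ)
    have e : ∀ x : α × (Fin n → α),
        ∏ i, f i (Fin.consEquiv (fun _ : Fin (n + 1) => α) x i) =
          f 0 x.1 * ∏ i : Fin n, f i.succ (x.2 i) := fun x => by
      rw [Fin.prod_univ_succ]; simp [Fin.consEquiv]
    constructor
    · rw [← (Fin.consEquiv (fun _ : Fin (n + 1) => α)).summable_iff]
      refine ((hf 0).mul_of_nonneg h1 (fun _ => norm_nonneg _) fun _ => norm_nonneg _).congr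
        fun x => ?_
      rw [Function.comp_apply, e, norm_mul]
    · rw [← (Fin.consEquiv (fun _ : Fin (n + 1) => α)).tsum_eq, tsum_congr e, Fin.prod_univ_succ,
        ← h2, tsum_mul_tsum_of_summable_norm (hf 0) h1]

namespace YoungDiagram

/-- The arm lengths of the boxes on the main diagonal. -/
def diagonalArms (μ : YoungDiagram) : Finset ℕ :=
  (μ.cells.filter fun v => v.1 = v.2).image fun v => μ.rowLen v.1 - v.1 - 1

theorem mem_diagonalArms {μ : YoungDiagram} {d : ℕ} :
    d ∈ μ.diagonalArms ↔ ∃ i, μ.rowLen i = i + 1 + d := by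
  simp only [diagonalArms, mem_image, mem_filter, mem_cells, Prod.exists]
  constructor
  · rintro ⟨i, j, ⟨h, rfl⟩, rfl⟩
    rw [mem_iff_lt_rowLen] at h
    exact ⟨i, by omega⟩
  · rintro ⟨i, hi⟩
    exact ⟨i, i, ⟨by rw [mem_iff_lt_rowLen]; omega, rfl⟩, by omega⟩

variable {μ : YoungDiagram}

theorem IsSelfConjugate.mem_swap (h : μ.IsSelfConjugate) {i j : ℕ} : (i, j) ∈ μ ↔ (j, i) ∈ μ := by
  conv_lhs => rw [← (show μ.transpose = μ from h), mem_transpose]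
  rfl

theorem IsSelfConjugate.lt_rowLen_swap (h : μ.IsSelfConjugate) {i j : ℕ} :
    j < μ.rowLen i ↔ i < μ.rowLen j := by
  rw [← mem_iff_lt_rowLen, ← mem_iff_lt_rowLen, h.mem_swap]

theorem IsSelfConjugate.lt_of_mem (h : μ.IsSelfConjugate) {i j : ℕ} (hij : (i, j) ∈ μ) :
    i < μ.rowLen 0 ∧ j < μ.rowLen 0 := by
  have h1 := mem_iff_lt_rowLen.1 hij
  have h2 := mem_iff_lt_rowLen.1 (h.mem_swap.1 hij)
  have h3 := μ.rowLen_anti _ _ (Nat.zero_le i)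
  have h4 := μ.rowLen_anti _ _ (Nat.zero_le j)
  omega

/-- The position of the `i`-th particle of the Maya diagram of `μ`. -/
def particle (μ : YoungDiagram) (i : ℕ) : ℤ :=
  μ.rowLen i - i - 1

theorem particle_strictAnti (μ : YoungDiagram) : StrictAnti μ.particle := by
  intro i j hij
  have := μ.rowLen_anti _ _ hij.le
  unfold particle; omega

theorem IsSelfConjugate.particle_add_pos (h : μ.IsSelfConjugate) {i j : ℕ} :
    0 < μ.particle i + μ.particle j + 1 ↔ (i, j) ∈ μ := by
  have h1 := h.lt_rowLen_swap (i := i) (j := j)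
  rw [mem_iff_lt_rowLen]
  unfold particle; omega

theorem IsSelfConjugate.particle_add_ne (h : μ.IsSelfConjugate) (i j : ℕ) :
    μ.particle i + μ.particle j + 1 ≠ 0 := by
  have h1 := h.lt_rowLen_swap (i := i) (j := j)
  unfold particle; omega

theorem IsSelfConjugate.hookLength_eq (h : μ.IsSelfConjugate) {i j : ℕ} (hij : (i, j) ∈ μ) :
    μ.hookLength (i, j) = (μ.particle i + μ.particle j + 1).toNat := by
  have h1 := mem_iff_lt_rowLen.1 hij
  have h2 := mem_iff_lt_rowLen.1 (h.mem_swap.1 hij)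
  have e : (μ.cells.filter fun u =>
      u = (i, j) ∨ (u.1 = (i, j).1 ∧ (i, j).2 < u.2) ∨ (u.2 = (i, j).2 ∧ (i, j).1 < u.1)) =
      (Ico j (μ.rowLen i)).image (fun k => (i, k)) ∪
        (Ioo i (μ.rowLen j)).image (fun k => (k, j)) := by
    ext ⟨a, b⟩
    simp only [mem_filter, mem_cells, mem_union, mem_image, mem_Ico, mem_Ioo, Prod.mk.injEq]
    constructor
    · rintro ⟨hab, ⟨rfl, rfl⟩ | ⟨rfl, hb⟩ | ⟨rfl, ha⟩⟩
      · exact Or.inl ⟨b, ⟨le_rfl, h1⟩, rfl, rfl⟩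
      · exact Or.inl ⟨b, ⟨hb.le, mem_iff_lt_rowLen.1 hab⟩, rfl, rfl⟩
      · exact Or.inr ⟨a, ⟨ha, mem_iff_lt_rowLen.1 (h.mem_swap.1 hab)⟩, rfl, rfl⟩
    · rintro (⟨k, ⟨hk, hk'⟩, rfl, rfl⟩ | ⟨k, ⟨hk, hk'⟩, rfl, rfl⟩)
      · refine ⟨mem_iff_lt_rowLen.2 hk', ?_⟩
        rcases hk.eq_or_lt with rfl | hk
        · exact Or.inl ⟨rfl, rfl⟩
        · exact Or.inr (Or.inl ⟨rfl, hk⟩)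
      · exact ⟨h.mem_swap.1 (mem_iff_lt_rowLen.2 hk'), Or.inr (Or.inr ⟨rfl, hk⟩)⟩
  rw [hookLength, e, card_union_of_disjoint, card_image_of_injective _ (Prod.mk_right_injective i),
    card_image_of_injective _ (Prod.mk_left_injective j), Nat.card_Ico, Nat.card_Ioo]
  · unfold particle; omega
  · rw [disjoint_left]
    intro x hx hx'
    simp only [mem_image, mem_Ico, mem_Ioo] at hx hx'
    obtain ⟨k, hk, rfl⟩ := hx
    obtain ⟨l, hl, h⟩ := hx'
    simp only [Prod.mk.injEq] at h
    omega

theorem lt_of_mem_diagonalArms {d : ℕ}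
    (hd : d ∈ μ.diagonalArms) : d < μ.rowLen 0 := by
  obtain ⟨i, hi⟩ := mem_diagonalArms.1 hd
  have := μ.rowLen_anti _ _ (Nat.zero_le i)
  omega

theorem IsSelfConjugate.exists_particle (h : μ.IsSelfConjugate) {N : ℕ} (hN : μ.rowLen 0 ≤ N)
    {m : ℕ} (hm : m < N) : ∃ i < N, μ.particle i = m ∨ μ.particle i = -1 - m := by
  let κ : ℕ → ℕ := fun i =>
    if 0 ≤ μ.particle i then (μ.particle i).toNat else (-1 - μ.particle i).toNat
  have hκ : ∀ i, (κ i : ℤ) = μ.particle i ∨ (κ i : ℤ) = -1 - μ.particle i := fun i => by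
    simp only [κ]
    split_ifs <;> omega
  have hmaps : ∀ i ∈ range N, κ i ∈ range N := by
    intro i hi
    have := μ.rowLen_anti _ _ (Nat.zero_le i)
    rw [mem_range] at hi ⊢
    have h1 := hκ i
    unfold particle at h1
    omega
  have hinj : Set.InjOn κ (range N) := by
    intro i _ j _ hij
    have hne := h.particle_add_ne i j
    have h1 := hκ i
    have h2 := hκ j
    refine μ.particle_strictAnti.injective ?_
    omega
  have hsurj := surj_on_of_inj_on_of_card_le (fun i _ => κ i) hmaps
    (fun i j hi hj hij => hinj hi hj hij) le_rfl m (mem_range.2 hm)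
  obtain ⟨i, hi, hmi⟩ := hsurj
  refine ⟨i, mem_range.1 hi, ?_⟩
  have h1 := hκ i
  omega

theorem IsSelfConjugate.image_particle (h : μ.IsSelfConjugate) {N : ℕ} (hN : μ.rowLen 0 ≤ N) :
    (range N).image μ.particle = μ.diagonalArms.image (fun d : ℕ => (d : ℤ)) ∪
      (range N \ μ.diagonalArms).image (fun m : ℕ => -1 - (m : ℤ)) := by
  ext x
  simp only [mem_image, mem_union, mem_sdiff, mem_range]
  constructor
  · rintro ⟨i, hi, rfl⟩
    rcases le_or_gt 0 (μ.particle i) with h0 | h0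
    · left
      refine ⟨(μ.particle i).toNat, mem_diagonalArms.2 ⟨i, ?_⟩, by omega⟩
      unfold particle at *; omega
    · right
      refine ⟨(-1 - μ.particle i).toNat, ⟨?_, ?_⟩, by omega⟩
      · unfold particle at *; omega
      · intro hd
        obtain ⟨j, hj⟩ := mem_diagonalArms.1 hd
        refine h.particle_add_ne i j ?_
        have : μ.particle j = (-1 - μ.particle i).toNat := by
          unfold particle at hj ⊢; omega
        omega
  · rintro (⟨d, hd, rfl⟩ | ⟨m, ⟨hm, hm'⟩, rfl⟩)
    · obtain ⟨i, hi⟩ := mem_diagonalArms.1 hd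
      refine ⟨i, ?_, by unfold particle; omega⟩
      exact (h.lt_of_mem (mem_iff_lt_rowLen.2 (by omega : i < μ.rowLen i))).1.trans_le hN
    · obtain ⟨i, hi, h1 | h1⟩ := h.exists_particle hN hm
      · exact absurd (mem_diagonalArms.2 ⟨i, by unfold particle at h1; omega⟩) hm'
      · exact ⟨i, hi, h1⟩

@[to_additive]
theorem IsSelfConjugate.prod_particle {M : Type*} [CommMonoid M] (h : μ.IsSelfConjugate) {N : ℕ}
    (hN : μ.rowLen 0 ≤ N) (g : ℤ → M) : ∏ i ∈ range N, g (μ.particle i) =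
      (∏ d ∈ μ.diagonalArms, g d) * ∏ m ∈ range N \ μ.diagonalArms, g (-1 - m) := by
  rw [← prod_image (f := g) μ.particle_strictAnti.injective.injOn, h.image_particle hN, prod_union,
    prod_image, prod_image]
  · intro a _ b _ hab; simpa using hab
  · intro a _ b _ hab; simpa using hab
  · rw [disjoint_left]
    intro x hx hx'
    obtain ⟨a, -, rfl⟩ := mem_image.1 hx
    obtain ⟨b, -, hb⟩ := mem_image.1 hx'
    omega

theorem IsSelfConjugate.cells_subset (h : μ.IsSelfConjugate) :
    μ.cells ⊆ range (μ.rowLen 0) ×ˢ range (μ.rowLen 0) := by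
  rintro ⟨i, j⟩ hij
  rw [mem_product, mem_range, mem_range]
  exact h.lt_of_mem ((mem_cells _).1 hij)

theorem IsSelfConjugate.prod_hookLength {M : Type*} [CommMonoid M] (h : μ.IsSelfConjugate)
    (φ : ℕ → M) :
    ∏ v ∈ μ.cells, φ (μ.hookLength v) = hookProd φ (μ.diagonalArms, μ.diagonalArms) := by
  set N := μ.rowLen 0 with hN
  set D := μ.diagonalArms with hD
  let ψ : ℤ → M := fun z => if 0 < z then φ z.toNat else 1
  have h1 : ∏ v ∈ μ.cells, φ (μ.hookLength v) =
      ∏ i ∈ range N, ∏ j ∈ range N, ψ (μ.particle i + μ.particle j + 1) := by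
    rw [← prod_product', ← prod_subset h.cells_subset]
    · refine prod_congr rfl ?_
      rintro ⟨i, j⟩ hij
      rw [mem_cells] at hij
      simp only [ψ, if_pos (h.particle_add_pos.2 hij), h.hookLength_eq hij]
    · rintro ⟨i, j⟩ - hij
      rw [mem_cells] at hij
      simp only [ψ, if_neg (fun h' => hij (h.particle_add_pos.1 h'))]
  have h2 : ∀ d ∈ D, ∏ m ∈ range N \ D, ψ ((d : ℤ) - m) = ∏ m ∈ range d \ D, φ (d - m) := by
    intro d hd
    have hdN : d < N := lt_of_mem_diagonalArms hd
    rw [← prod_subset (sdiff_subset_sdiff (range_mono hdN.le) (subset_refl D))]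
    · refine prod_congr rfl fun m hm => ?_
      have := mem_range.1 (mem_sdiff.1 hm).1
      simp only [ψ]
      rw [if_pos (by omega)]; congr 1; omega
    · intro m hm hm'
      simp only [mem_sdiff, mem_range] at hm hm'
      simp only [ψ]
      rw [if_neg]
      have : ¬ m < d := fun h' => hm' ⟨h', hm.2⟩
      omega
  have h3 : ∀ x, ∏ j ∈ range N, ψ (x + μ.particle j + 1) =
      (∏ d ∈ D, ψ (x + d + 1)) * ∏ m ∈ range N \ D, ψ (x + (-1 - m) + 1) := fun x =>
    h.prod_particle le_rfl fun y => ψ (x + y + 1)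
  rw [h1, h.prod_particle le_rfl fun x => ∏ j ∈ range N, ψ (x + μ.particle j + 1)]
  simp only [h3]
  rw [prod_mul_distrib, prod_mul_distrib, ← hN, ← hD]
  have e1 : ∏ d ∈ D, ∏ d' ∈ D, ψ ((d : ℤ) + d' + 1) = ∏ d ∈ D, ∏ d' ∈ D, φ (d + d' + 1) := by
    refine prod_congr rfl fun d _ => prod_congr rfl fun d' _ => ?_
    simp only [ψ]
    rw [if_pos (by omega)]; congr 1
  have e2 : ∏ d ∈ D, ∏ m ∈ range N \ D, ψ ((d : ℤ) + (-1 - m) + 1) = betaProd φ D := by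
    refine prod_congr rfl fun d hd => ?_
    rw [← h2 d hd]
    refine prod_congr rfl fun m _ => congrArg ψ (by ring)
  have e3 : ∏ m ∈ range N \ D, ∏ d ∈ D, ψ (-1 - (m : ℤ) + d + 1) = betaProd φ D := by
    rw [prod_comm]
    refine prod_congr rfl fun d hd => ?_
    rw [← h2 d hd]
    refine prod_congr rfl fun m _ => congrArg ψ (by ring)
  have e4 : ∏ m ∈ range N \ D, ∏ m' ∈ range N \ D, ψ (-1 - (m : ℤ) + (-1 - m') + 1) = 1 :=
    prod_eq_one fun m _ => prod_eq_one fun m' _ => if_neg (by omega)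
  rw [e1, e2, e3, e4, mul_one, hookProd]

theorem IsSelfConjugate.card_eq (h : μ.IsSelfConjugate) :
    μ.card = ∑ d ∈ μ.diagonalArms, (2 * d + 1) := by
  have h1 := h.prod_hookLength (fun _ => 2)
  rw [prod_const, hookProd_const] at h1
  have h2 : μ.card = hookCount (μ.diagonalArms, μ.diagonalArms) :=
    Nat.pow_right_injective le_rfl h1
  have h3 := energy_eq (μ.diagonalArms, μ.diagonalArms)
  rw [← h2, energy, charge] at h3
  push_cast at h3
  rw [sub_self] at h3
  zify
  linarith

theorem IsSelfConjugate.bgRank_eq (h : μ.IsSelfConjugate) :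
    μ.bgRank = ∑ d ∈ μ.diagonalArms, (-1) ^ d := by
  set N := μ.rowLen 0 with hN
  let χ : ℤ → ℤ := fun x => if Even x then 1 else -1
  have hχ : ∀ k : ℕ, (-1 : ℤ) ^ k = χ k := fun k => by
    simp only [χ, Int.even_coe_nat]
    split_ifs with hk
    · exact hk.neg_one_pow
    · exact (Nat.not_even_iff_odd.1 hk).neg_one_pow
  have hrow : ∀ i k : ℕ, 2 * ∑ j ∈ range k, (-1 : ℤ) ^ (i + j) = (-1) ^ i - (-1) ^ (i + k) := by
    intro i k
    induction k with
    | zero => simp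
    | succ k ih =>
      rw [sum_range_succ, mul_add, ih, ← add_assoc, pow_succ _ (i + k)]; ring
  have h1 : μ.bgRank = ∑ i ∈ range N, ∑ j ∈ range (μ.rowLen i), (-1 : ℤ) ^ (i + j) := by
    rw [bgRank, sum_sigma']
    refine sum_nbij' (fun v => ⟨v.1, v.2⟩) (fun v => (v.1, v.2)) ?_ ?_ ?_ ?_ ?_
    · rintro ⟨i, j⟩ hij
      rw [mem_cells] at hij
      simp only [mem_sigma, mem_range]
      exact ⟨(h.lt_of_mem hij).1, mem_iff_lt_rowLen.1 hij⟩
    · rintro ⟨i, j⟩ hij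
      simp only [mem_sigma, mem_range] at hij
      exact (mem_cells _).2 (mem_iff_lt_rowLen.2 hij.2)
    · intro _ _; rfl
    · intro _ _; rfl
    · intro _ _; rfl
  have h2 : 2 * μ.bgRank = ∑ i ∈ range N, χ i + ∑ i ∈ range N, χ (μ.particle i) := by
    rw [h1, mul_sum, ← sum_add_distrib]
    refine sum_congr rfl fun i _ => ?_
    rw [hrow, hχ, hχ, sub_eq_add_neg]
    congr 1
    simp only [χ, particle]
    push_cast
    split_ifs <;> simp_all only [Int.even_iff] <;> omega
  have h3 : ∀ m : ℕ, χ (-1 - (m : ℤ)) = - χ m := fun m => by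
    simp only [χ]
    split_ifs <;> simp_all only [Int.even_iff] <;> omega
  have hsub : μ.diagonalArms ⊆ range N := fun d hd => mem_range.2 (lt_of_mem_diagonalArms hd)
  have h4 := sum_sdiff (f := fun m : ℕ => χ m) hsub
  rw [h.sum_particle le_rfl χ] at h2
  simp only [h3, sum_neg_distrib] at h2
  simp only [hχ]
  linarith

theorem diagonalArms_injOn {μ ν : YoungDiagram} (hμ : μ.IsSelfConjugate) (hν : ν.IsSelfConjugate)
    (h : μ.diagonalArms = ν.diagonalArms) : μ = ν := by
  have hsub : ∀ {μ ν : YoungDiagram}, μ.IsSelfConjugate → ν.IsSelfConjugate →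
      μ.diagonalArms = ν.diagonalArms →
      Set.range (fun i => -μ.particle i) ⊆ Set.range fun i => -ν.particle i := by
    rintro μ ν hμ hν h _ ⟨i, rfl⟩
    have h1 := hμ.image_particle (le_max_right (i + 1) (max (μ.rowLen 0) (ν.rowLen 0))
      |>.trans' (le_max_left _ _))
    rw [h, ← hν.image_particle (le_max_right (i + 1) (max (μ.rowLen 0) (ν.rowLen 0))
      |>.trans' (le_max_right _ _))] at h1
    have h2 : μ.particle i ∈ (range (max (i + 1) (max (μ.rowLen 0) (ν.rowLen 0)))).image
        μ.particle := mem_image_of_mem _ (mem_range.2 (by omega))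
    rw [h1] at h2
    obtain ⟨j, -, hj⟩ := mem_image.1 h2
    exact ⟨j, by simp [hj]⟩
  have hmono : ∀ μ : YoungDiagram, StrictMono fun i => -μ.particle i :=
    fun μ i j hij => neg_lt_neg (μ.particle_strictAnti hij)
  have he := ((hmono μ).range_inj (hmono ν)).1
    ((hsub hμ hν h).antisymm (hsub hν hμ h.symm))
  ext ⟨i, j⟩
  have h1 := congrFun he i
  simp only [particle] at h1
  rw [mem_cells, mem_cells, mem_iff_lt_rowLen, mem_iff_lt_rowLen]
  omega

/-- The self-conjugate diagram with a given set of arm lengths of its diagonal boxes. -/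
def ofDiagonalArms (D : Finset ℕ) : YoungDiagram where
  cells := D.biUnion fun d =>
    (range (d + #(D.filter (d < ·)) + 1) ×ˢ range (d + #(D.filter (d < ·)) + 1)).filter
      fun v => min v.1 v.2 ≤ #(D.filter (d < ·))
  isLowerSet := by
    rintro ⟨i, j⟩ ⟨i', j'⟩ ⟨hi, hj⟩ h
    simp only [coe_biUnion, Set.mem_iUnion, mem_coe, mem_filter, mem_product, mem_range] at h ⊢
    simp only at hi hj
    obtain ⟨d, hd, h⟩ := h
    exact ⟨d, hd, by omega⟩

theorem mem_ofDiagonalArms {D : Finset ℕ} {i j : ℕ} : (i, j) ∈ ofDiagonalArms D ↔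
    ∃ d ∈ D, max i j ≤ d + #(D.filter (d < ·)) ∧ min i j ≤ #(D.filter (d < ·)) := by
  rw [← mem_cells, ofDiagonalArms]
  simp only [mem_biUnion, mem_filter, mem_product, mem_range]
  refine exists_congr fun d => and_congr_right fun _ => ?_
  omega

theorem isSelfConjugate_ofDiagonalArms (D : Finset ℕ) : (ofDiagonalArms D).IsSelfConjugate := by
  refine YoungDiagram.ext ?_
  ext ⟨i, j⟩
  rw [mem_cells, mem_cells, mem_transpose, Prod.swap_prod_mk, mem_ofDiagonalArms,
    mem_ofDiagonalArms, max_comm, min_comm]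

theorem diagonalArms_ofDiagonalArms (D : Finset ℕ) : (ofDiagonalArms D).diagonalArms = D := by
  have hlt : ∀ d ∈ D, #(D.filter (d < ·)) < #D := fun d hd =>
    card_lt_card (filter_ssubset.2 ⟨d, hd, lt_irrefl d⟩)
  symm
  refine eq_of_subset_of_card_le (fun d hd => ?_) ?_
  · rw [mem_diagonalArms]
    refine ⟨#(D.filter (d < ·)), eq_of_forall_lt_iff fun j => ?_⟩
    rw [← mem_iff_lt_rowLen, mem_ofDiagonalArms]
    constructor
    · rintro ⟨d', hd', h1, h2⟩
      by_contra hj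
      have h3 : #(D.filter (d < ·)) ≤ #(D.filter (d' < ·)) := by omega
      rcases lt_trichotomy d d' with h4 | rfl | h4
      · have : D.filter (d' < ·) ⊂ D.filter (d < ·) := by
          refine ssubset_iff_of_subset (fun x hx => ?_) |>.2 ⟨d', ?_, ?_⟩
          · simp only [mem_filter] at hx ⊢; exact ⟨hx.1, h4.trans hx.2⟩
          · simp [hd', h4]
          · simp
        have := card_lt_card this
        omega
      · omega
      · have : D.filter (d' < ·) ⊆ D.filter (d < ·) ∪ Ioc d' d := fun x hx => by
          simp only [mem_filter, mem_union, mem_Ioc] at hx ⊢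
          rcases le_or_gt x d with h5 | h5
          · exact Or.inr ⟨hx.2, h5⟩
          · exact Or.inl ⟨hx.1, h5⟩
        have := (card_le_card this).trans (card_union_le _ _)
        rw [Nat.card_Ioc] at this
        omega
    · intro hj
      exact ⟨d, hd, by omega, by omega⟩
  · have : (ofDiagonalArms D).cells.filter (fun v => v.1 = v.2) ⊆
        (range #D).image fun i => (i, i) := by
      rintro ⟨i, j⟩ hij
      simp only [mem_filter, mem_cells] at hij
      obtain ⟨hij, rfl⟩ := hij
      obtain ⟨d, hd, -, h2⟩ := mem_ofDiagonalArms.1 hij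
      rw [min_self] at h2
      exact mem_image.2 ⟨i, mem_range.2 (h2.trans_lt (hlt d hd)), rfl⟩
    refine (card_image_le.trans (card_le_card this)).trans (card_image_le.trans ?_)
    rw [card_range]

/-- Self-conjugate partitions correspond to finite sets of natural numbers. -/
def selfConjugateEquiv : {μ : YoungDiagram // μ.IsSelfConjugate} ≃ Finset ℕ where
  toFun μ := μ.1.diagonalArms
  invFun D := ⟨ofDiagonalArms D, isSelfConjugate_ofDiagonalArms D⟩
  left_inv μ := Subtype.ext (diagonalArms_injOn (isSelfConjugate_ofDiagonalArms _) μ.2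
    (diagonalArms_ofDiagonalArms _))
  right_inv := diagonalArms_ofDiagonalArms

end YoungDiagram

namespace YoungDiagram

theorem prod_hookLengthsMod {M : Type*} [CommMonoid M] (t : ℕ) (μ : YoungDiagram) (f : ℕ → M) :
    ((μ.hookLengthsMod t).map f).prod =
      ∏ v ∈ μ.cells, if t ∣ μ.hookLength v then f (μ.hookLength v) else 1 := by
  rw [hookLengthsMod, hookLengths, Multiset.filter_map, Multiset.map_map, ← prod_filter]
  rfl

theorem card_hookLengthsMod (t : ℕ) (μ : YoungDiagram) :
    (μ.hookLengthsMod t).card = #(μ.cells.filter fun v => t ∣ μ.hookLength v) := by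
  rw [hookLengthsMod, hookLengths, Multiset.filter_map, Multiset.card_map]
  rfl

/-- The `2 τ`-quotient of a self-conjugate partition, as a family of Maya diagrams. -/
noncomputable def quotient (τ : ℕ) (μ : YoungDiagram) : Fin τ → Finset ℕ × Finset ℕ :=
  splitResidues τ μ.diagonalArms

variable {μ : YoungDiagram} {τ : ℕ}

theorem mergeResidues_quotient (hτ : 0 < τ) (μ : YoungDiagram) :
    mergeResidues τ (μ.quotient τ) = μ.diagonalArms :=
  (residueEquiv τ hτ).symm_apply_apply _

theorem IsSelfConjugate.pow_mul_prod_hookLengthsMod {K : Type*} [Field K] (h : μ.IsSelfConjugate)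
    (hτ : 0 < τ) (x : K) : x ^ (μ.hookLengthsMod (2 * τ)).card *
      ((μ.hookLengthsMod (2 * τ)).map fun h : ℕ => 1 / (h : K)).prod =
      ∏ r, hookProd (fun h : ℕ => x / (2 * τ) / h) (μ.quotient τ r) ^ 2 := by
  rw [prod_hookLengthsMod, card_hookLengthsMod, ← prod_const, prod_filter, ← prod_mul_distrib]
  have h1 := h.prod_hookLength fun k : ℕ => if 2 * τ ∣ k then x / (k : K) else 1
  rw [← mergeResidues_quotient hτ, hookProd_mergeResidues] at h1
  · refine Eq.trans (prod_congr rfl fun v _ => ?_) (h1.trans ?_)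
    · split_ifs <;> simp [div_eq_mul_inv]
    · refine prod_congr rfl fun r _ => ?_
      congr 2
      funext k
      simp [div_div]
  · intro k hk
    exact if_neg hk

theorem IsSelfConjugate.card_hookLengthsMod_eq (h : μ.IsSelfConjugate) (hτ : 0 < τ) :
    (μ.hookLengthsMod (2 * τ)).card = 2 * ∑ r, hookCount (μ.quotient τ r) := by
  have h1 := h.prod_hookLength fun k : ℕ => if 2 * τ ∣ k then 2 else 1
  rw [← prod_filter, prod_const, ← mergeResidues_quotient hτ, hookProd_mergeResidues] at h1
  · simp only [dvd_mul_right, if_true, hookProd_const, ← pow_mul, prod_pow_eq_pow_sum] at h1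
    rw [card_hookLengthsMod, Nat.pow_right_injective le_rfl h1, ← sum_mul, mul_comm]
  · intro k hk
    exact if_neg hk

end YoungDiagram

/-- The parameter of the `r`-th Maya diagram. -/
noncomputable def residueParam (τ : ℕ) (q b : ℂ) (r : Fin τ) : ℂ :=
  b ^ ((-1 : ℤ) ^ (r : ℕ)) * q ^ (2 * (r : ℤ) + 1 - 2 * τ)

theorem pow_mul_zpow_mergeResidues {q b : ℂ} (hq : q ≠ 0) (hb : b ≠ 0) {τ : ℕ}
    (p : Fin τ → Finset ℕ × Finset ℕ) :
    q ^ (∑ d ∈ mergeResidues τ p, (2 * d + 1)) * b ^ (∑ d ∈ mergeResidues τ p, (-1 : ℤ) ^ d) =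
      ∏ r, mayaWeight (residueParam τ q b r) (q ^ (2 * τ)) (p r) := by
  have h1 := sum_two_mul_add_one_mergeResidues τ p
  rw [← zpow_natCast, sum_neg_one_pow_mergeResidues]
  push_cast
  rw [h1]
  have hz : ∀ {a : ℂ}, a ≠ 0 → ∀ (s : Finset (Fin τ)) (f : Fin τ → ℤ),
      a ^ (∑ r ∈ s, f r) = ∏ r ∈ s, a ^ f r := by
    intro a ha s f
    induction s using Finset.induction_on with
    | empty => simp
    | insert i s hi ih => rw [sum_insert hi, prod_insert hi, zpow_add₀ ha, ih]
  rw [hz hq, hz hb, ← prod_mul_distrib]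
  refine prod_congr rfl fun r _ => ?_
  rw [mayaWeight, residueParam, mul_zpow, ← zpow_mul, ← zpow_mul, zpow_add₀ hq, ← pow_mul,
    ← zpow_natCast q (2 * τ * _)]
  push_cast
  ring

theorem residueParam_ne_zero {q b : ℂ} (hq : q ≠ 0) (hb : b ≠ 0) {τ : ℕ} (r : Fin τ) :
    residueParam τ q b r ≠ 0 :=
  mul_ne_zero (zpow_ne_zero _ hb) (zpow_ne_zero _ hq)

theorem norm_pow_two_mul_lt_one {q : ℂ} (hq1 : ‖q‖ < 1) {τ : ℕ} (hτ : 0 < τ) :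
    ‖q ^ (2 * τ)‖ < 1 := by
  rw [norm_pow]; exact pow_lt_one₀ (norm_nonneg _) hq1 (by omega)

theorem prod_tsum_mayaWeight {q b : ℂ} (hq1 : ‖q‖ < 1) (hq : q ≠ 0) (hb : b ≠ 0) {τ : ℕ}
    (hτ : 0 < τ) : ∏ r, ∑' p, mayaWeight (residueParam τ q b r) (q ^ (2 * τ)) p =
      ∑' D : Finset ℕ, q ^ (∑ d ∈ D, (2 * d + 1)) * b ^ (∑ d ∈ D, (-1 : ℤ) ^ d) := by
  rw [← (summable_and_tsum_pi fun r => summable_norm_mayaWeight (residueParam_ne_zero hq hb r)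
    (norm_pow_two_mul_lt_one hq1 hτ)).2, ← (residueEquiv τ hτ).symm.tsum_eq]
  exact tsum_congr fun p => (pow_mul_zpow_mergeResidues hq hb p).symm

theorem tsum_pow_mul_zpow {q b : ℂ} (hq1 : ‖q‖ < 1) (hq : q ≠ 0) (hb : b ≠ 0) :
    ∑' D : Finset ℕ, q ^ (∑ d ∈ D, (2 * d + 1)) * b ^ (∑ d ∈ D, (-1 : ℤ) ^ d) =
      qPochhammerInf (-(b * q)) (q ^ 4) * qPochhammerInf (-(q ^ 3 / b)) (q ^ 4) := by
  rw [← prod_tsum_mayaWeight hq1 hq hb one_pos, Fin.prod_univ_one,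
    tsum_mayaWeight_eq_tprod (residueParam_ne_zero hq hb _) (norm_pow_two_mul_lt_one hq1 one_pos),
    qPochhammerInf, qPochhammerInf]
  have e : residueParam 1 q b 0 = b / q := by
    simp [residueParam, div_eq_mul_inv]
  rw [e]
  congr 1
  · refine tprod_congr fun m => ?_
    rw [← pow_mul, show 2 * 1 * (2 * m + 1) = 4 * m + 2 by ring, ← pow_mul, pow_add]
    field_simp
    ring
  · refine tprod_congr fun m => ?_
    rw [← pow_mul, show 2 * 1 * (2 * m + 1) = 4 * m + 2 by ring, ← pow_mul, pow_add]
    field_simp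
    ring

theorem hasSum_selfConjugate_of_ne_zero {q b : ℂ} (hq1 : ‖q‖ < 1) (hq : q ≠ 0) (hb : b ≠ 0) (x : ℂ)
    {τ : ℕ} (hτ : 0 < τ) :
    HasSum
      (fun μ : {μ : YoungDiagram // μ.IsSelfConjugate} =>
        q ^ μ.1.card * x ^ (μ.1.hookLengthsMod (2 * τ)).card * b ^ μ.1.bgRank *
          ((μ.1.hookLengthsMod (2 * τ)).map fun h : ℕ => 1 / (h : ℂ)).prod)
      (qPochhammerInf (q ^ (4 * τ)) (q ^ (4 * τ)) ^ τ *
        qPochhammerInf (-(b * q)) (q ^ 4) *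
        qPochhammerInf (-(q ^ 3 / b)) (q ^ 4) *
        Complex.exp (x ^ 2 * q ^ (4 * τ) / (4 * (τ : ℂ)))) := by
  have hterm : ∀ r : Fin τ, _ := fun r => hasSum_mayaWeight_hookProd (residueParam_ne_zero hq hb r)
    (norm_pow_two_mul_lt_one hq1 hτ) (x / (2 * τ))
  obtain ⟨h1, h2⟩ := summable_and_tsum_pi fun r => (hterm r).1
  have h3 := h1.of_norm.hasSum
  rw [h2, ← (YoungDiagram.selfConjugateEquiv.trans (residueEquiv τ hτ)).hasSum_iff] at h3
  have hlim : qPochhammerInf (q ^ (4 * τ)) (q ^ (4 * τ)) ^ τ *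
        qPochhammerInf (-(b * q)) (q ^ 4) * qPochhammerInf (-(q ^ 3 / b)) (q ^ 4) *
        Complex.exp (x ^ 2 * q ^ (4 * τ) / (4 * (τ : ℂ))) =
      ∏ r, ∑' p, mayaWeight (residueParam τ q b r) (q ^ (2 * τ)) p *
        hookProd (fun h : ℕ => x / (2 * τ) / h) p ^ 2 := by
    have hQ : (q ^ (2 * τ)) ^ 2 = q ^ (4 * τ) := by rw [← pow_mul]; congr 1; ring
    rw [prod_congr rfl fun r _ => (hterm r).2, prod_mul_distrib, prod_mul_distrib,
      prod_tsum_mayaWeight hq1 hq hb hτ, tsum_pow_mul_zpow hq1 hq hb, prod_const, prod_const,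
      ← Complex.exp_nat_mul, hQ, card_univ, Fintype.card_fin]
    have e1 : (∏' m : ℕ, (1 - (q ^ (4 * τ)) ^ (m + 1))) =
        qPochhammerInf (q ^ (4 * τ)) (q ^ (4 * τ)) := tprod_congr fun m => by rw [pow_succ']
    have e2 : (τ : ℂ) * (q ^ (4 * τ) * (x / (2 * τ)) ^ 2) = x ^ 2 * q ^ (4 * τ) / (4 * τ) := by
      have : (τ : ℂ) ≠ 0 := by exact_mod_cast hτ.ne'
      field_simp
      ring
    rw [e1, e2]
    ring
  rw [hlim]
  refine h3.congr_fun fun μ => ?_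
  have h4 := μ.2.pow_mul_prod_hookLengthsMod hτ x
  have h5 := pow_mul_zpow_mergeResidues hq hb (μ.1.quotient τ)
  rw [YoungDiagram.mergeResidues_quotient hτ, ← μ.2.card_eq, ← μ.2.bgRank_eq] at h5
  change _ = ∏ r, mayaWeight (residueParam τ q b r) (q ^ (2 * τ)) (μ.1.quotient τ r) *
    hookProd (fun h : ℕ => x / (2 * τ) / h) (μ.1.quotient τ r) ^ 2
  rw [prod_mul_distrib, ← h4, ← h5]
  ring

theorem hasSum_selfConjugate_zero (x b : ℂ) (t : ℕ) :
    HasSum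
      (fun μ : {μ : YoungDiagram // μ.IsSelfConjugate} =>
        (0 : ℂ) ^ μ.1.card * x ^ (μ.1.hookLengthsMod t).card * b ^ μ.1.bgRank *
          ((μ.1.hookLengthsMod t).map fun h : ℕ => 1 / (h : ℂ)).prod) 1 := by
  have hbot : (⊥ : YoungDiagram).IsSelfConjugate := YoungDiagram.ext (by
    ext ⟨i, j⟩; simp [YoungDiagram.mem_transpose])
  convert hasSum_single (⟨⊥, hbot⟩ : {μ : YoungDiagram // μ.IsSelfConjugate}) ?_ using 1
  · have : (⊥ : YoungDiagram).card = 0 := rfl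
    simp [this, YoungDiagram.hookLengthsMod, YoungDiagram.hookLengths, YoungDiagram.bgRank]
  · rintro ⟨μ, hμ⟩ hne
    have : μ.card ≠ 0 := fun h => hne (Subtype.ext (YoungDiagram.ext (by
      rw [card_eq_zero.1 h]; rfl)))
    simp [this]

theorem sum_two_mul_add_one_eq (D : Finset ℕ) :
    ∑ d ∈ D, (2 * (d : ℤ) + 1) =
      (∑ d ∈ D, (-1 : ℤ) ^ d) * (2 * (∑ d ∈ D, (-1 : ℤ) ^ d) - 1) +
        4 * hookCount (splitResidues 1 D 0) := by
  obtain ⟨p, rfl⟩ := (residueEquiv 1 one_pos).symm.surjective D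
  have h : splitResidues 1 ((residueEquiv 1 one_pos).symm p) = p :=
    (residueEquiv 1 one_pos).apply_symm_apply p
  have h1 := sum_two_mul_add_one_mergeResidues 1 p
  have h2 := sum_neg_one_pow_mergeResidues 1 p
  have h3 := energy_eq (p 0)
  rw [Fin.sum_univ_one] at h1 h2
  rw [h]
  change ∑ d ∈ mergeResidues 1 p, (2 * (d : ℤ) + 1) = (∑ d ∈ mergeResidues 1 p, (-1 : ℤ) ^ d) *
    (2 * (∑ d ∈ mergeResidues 1 p, (-1 : ℤ) ^ d) - 1) + _
  rw [h1, h2, h3]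
  simp
  ring

/-- The diagonal arms of the smallest self-conjugate partition of BG-rank `j`. -/
def minimalArms (j : ℤ) : Finset ℕ :=
  mergeResidues 1 fun _ => groundState j

theorem eq_minimalArms {D : Finset ℕ} (h : hookCount (splitResidues 1 D 0) = 0) :
    D = minimalArms (∑ d ∈ D, (-1 : ℤ) ^ d) := by
  obtain ⟨p, rfl⟩ := (residueEquiv 1 one_pos).symm.surjective D
  have hp : splitResidues 1 ((residueEquiv 1 one_pos).symm p) = p :=
    (residueEquiv 1 one_pos).apply_symm_apply p
  rw [hp] at h
  have h2 := sum_neg_one_pow_mergeResidues 1 p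
  rw [Fin.sum_univ_one] at h2
  change mergeResidues 1 p = minimalArms (∑ d ∈ mergeResidues 1 p, (-1 : ℤ) ^ d)
  rw [h2, minimalArms]
  congr 1
  funext r
  rw [Subsingleton.elim r 0, eq_groundState h]
  simp [charge_groundState]

theorem sum_neg_one_pow_minimalArms (j : ℤ) : ∑ d ∈ minimalArms j, (-1 : ℤ) ^ d = j := by
  rw [minimalArms, sum_neg_one_pow_mergeResidues]
  simp [charge_groundState]

theorem sum_two_mul_add_one_minimalArms (j : ℤ) :
    ∑ d ∈ minimalArms j, (2 * (d : ℤ) + 1) = j * (2 * j - 1) := by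
  rw [minimalArms, sum_two_mul_add_one_mergeResidues]
  simp only [univ_unique, Fin.default_eq_zero, sum_singleton, energy_eq, charge_groundState,
    hookCount_groundState]
  simp
  ring

/-- The size of the self-conjugate `2 τ`-core with charges `c`. -/
def coreSize {τ : ℕ} (c : Fin τ → ℤ) : ℤ :=
  ∑ r : Fin τ, (2 * τ * c r ^ 2 + (2 * r + 1 - 2 * τ) * c r)

/-- The BG-rank of a self-conjugate partition whose `2 τ`-core has charges `c`. -/
def coreRank {τ : ℕ} (c : Fin τ → ℤ) : ℤ :=
  ∑ r : Fin τ, (-1) ^ (r : ℕ) * c r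

theorem sum_mergeResidues_eq_coreSize {τ : ℕ} (p : Fin τ → Finset ℕ × Finset ℕ) :
    ∑ d ∈ mergeResidues τ p, (2 * (d : ℤ) + 1) =
      coreSize (fun r => charge (p r)) + 4 * τ * ∑ r, (hookCount (p r) : ℤ) := by
  rw [sum_two_mul_add_one_mergeResidues, coreSize, mul_sum, ← sum_add_distrib]
  refine sum_congr rfl fun r _ => ?_
  rw [energy_eq]; ring

theorem coreRank_mul_le_coreSize {τ : ℕ} (c : Fin τ → ℤ) :
    coreRank c * (2 * coreRank c - 1) ≤ coreSize c := by
  have h1 := sum_mergeResidues_eq_coreSize fun r => groundState (c r)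
  have h2 := sum_neg_one_pow_mergeResidues τ fun r => groundState (c r)
  simp only [charge_groundState, hookCount_groundState] at h1 h2
  simp only [Nat.cast_zero, sum_const_zero, mul_zero, add_zero] at h1
  change _ = coreSize c at h1
  change _ = coreRank c at h2
  rw [sum_two_mul_add_one_eq, h2] at h1
  omega

/-- The charges of the `2 τ`-quotient of the smallest self-conjugate partition of BG-rank `j`. -/
noncomputable def minimalCharges (τ : ℕ) (j : ℤ) (r : Fin τ) : ℤ :=
  charge (splitResidues τ (minimalArms j) r)

theorem coreRank_minimalCharges {τ : ℕ} (hτ : 0 < τ) (j : ℤ) :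
    coreRank (minimalCharges τ j) = j := by
  have h : mergeResidues τ (splitResidues τ (minimalArms j)) = minimalArms j :=
    (residueEquiv τ hτ).symm_apply_apply _
  have h1 := sum_neg_one_pow_mergeResidues τ (splitResidues τ (minimalArms j))
  rw [h, sum_neg_one_pow_minimalArms] at h1
  exact h1.symm

theorem coreSize_minimalCharges {τ : ℕ} (hτ : 0 < τ) (j : ℤ) :
    coreSize (minimalCharges τ j) = j * (2 * j - 1) := by
  have h : mergeResidues τ (splitResidues τ (minimalArms j)) = minimalArms j :=
    (residueEquiv τ hτ).symm_apply_apply _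
  have h1 := sum_mergeResidues_eq_coreSize (splitResidues τ (minimalArms j))
  rw [h, sum_two_mul_add_one_minimalArms] at h1
  have h2 := coreRank_mul_le_coreSize (minimalCharges τ j)
  rw [coreRank_minimalCharges hτ] at h2
  refine le_antisymm ?_ h2
  rw [h1]
  exact le_add_of_nonneg_right (by positivity)

theorem eq_minimalCharges {τ : ℕ} (hτ : 0 < τ) {c : Fin τ → ℤ}
    (h : coreSize c = coreRank c * (2 * coreRank c - 1)) : c = minimalCharges τ (coreRank c) := by
  have h1 := sum_mergeResidues_eq_coreSize fun r => groundState (c r)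
  have h2 := sum_neg_one_pow_mergeResidues τ fun r => groundState (c r)
  simp only [charge_groundState, hookCount_groundState] at h1 h2
  simp only [Nat.cast_zero, sum_const_zero, mul_zero, add_zero] at h1
  change _ = coreSize c at h1
  change _ = coreRank c at h2
  rw [sum_two_mul_add_one_eq, h2, h] at h1
  have h3 := eq_minimalArms (D := mergeResidues τ fun r => groundState (c r)) (by omega)
  rw [h2] at h3
  have h4 : splitResidues τ (mergeResidues τ fun r => groundState (c r)) =
      fun r => groundState (c r) := (residueEquiv τ hτ).apply_symm_apply _
  funext r
  rw [minimalCharges, ← h3, h4, charge_groundState]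

theorem sum_piAntidiag_div_factorial (τ n : ℕ) (y : ℚ) :
    ∑ k ∈ piAntidiag (univ : Finset (Fin τ)) n, ∏ r, y ^ k r / ((k r).factorial : ℚ) =
      (τ * y) ^ n / (n.factorial : ℚ) := by
  have h := sum_pow_eq_sum_piAntidiag (univ : Finset (Fin τ)) (fun _ => y) n
  rw [sum_const, card_univ, Fintype.card_fin, nsmul_eq_mul] at h
  rw [h, sum_div]
  refine sum_congr rfl fun k hk => ?_
  have h1 := Nat.multinomial_spec (univ : Finset (Fin τ)) k
  rw [(mem_piAntidiag.1 hk).1] at h1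
  rw [← h1, prod_div_distrib]
  have h2 : ((∏ r, (k r).factorial : ℕ) : ℚ) ≠ 0 := by
    exact_mod_cast prod_ne_zero_iff.2 fun r _ => Nat.factorial_ne_zero _
  have h3 : (Nat.multinomial univ k : ℚ) ≠ 0 := by
    have : Nat.multinomial univ k ≠ 0 := fun h0 => by
      rw [h0, mul_zero] at h1; exact Nat.factorial_ne_zero _ h1.symm
    exact_mod_cast this
  push_cast at h2 ⊢
  field_simp

namespace YoungDiagram

theorem mem_selfConjugateOfSize {N : ℕ} {μ : YoungDiagram} :
    μ ∈ selfConjugateOfSize N ↔ μ.IsSelfConjugate ∧ μ.card = N := by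
  simp [selfConjugateOfSize]

theorem sum_selfConjugate_minimal {τ : ℕ} (hτ : 0 < τ) (j : ℤ) (n N : ℕ)
    (hN : (N : ℤ) = 4 * τ * n + j * (2 * j - 1)) :
    ∑ μ ∈ (selfConjugateOfSize N).filter
        (fun μ => (μ.hookLengthsMod (2 * τ)).card = 2 * n ∧ μ.bgRank = j),
      ((μ.hookLengthsMod (2 * τ)).map fun h : ℕ => 1 / (h : ℚ)).prod =
      1 / ((n.factorial : ℚ) * (4 * τ) ^ n) := by
  set c := minimalCharges τ j with hc
  set g : Finset ℕ × Finset ℕ → ℚ := fun p => hookProd (fun h : ℕ => 1 / (2 * τ) / (h : ℚ)) p ^ 2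
    with hg
  have hsum : ∀ (c : ℤ) (k : ℕ), ∑ p ∈ mayaDiagrams c k, g p =
      (1 / (2 * (τ : ℚ)) ^ 2) ^ k / (k.factorial : ℚ) := by
    intro c k
    rw [div_eq_mul_one_div, ← sum_sq_hookProd c k, mul_sum, one_div, ← inv_pow, ← pow_mul]
    refine sum_congr rfl fun p hp => ?_
    simp only [hg, div_eq_mul_inv, hookProd_mul, hookProd_const, (mem_mayaDiagrams.1 hp).2]
    ring
  have hsplit : ∀ p : Fin τ → Finset ℕ × Finset ℕ,
      (ofDiagonalArms (mergeResidues τ p)).quotient τ = p := fun p => by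
    rw [quotient, diagonalArms_ofDiagonalArms]
    exact (residueEquiv τ hτ).apply_symm_apply p
  have hsize : ∀ {μ : YoungDiagram}, μ.IsSelfConjugate → (μ.card : ℤ) =
      coreSize (fun r => charge (μ.quotient τ r)) +
        4 * τ * ∑ r, (hookCount (μ.quotient τ r) : ℤ) := fun {μ} h => by
    rw [← sum_mergeResidues_eq_coreSize, mergeResidues_quotient hτ, h.card_eq]
    push_cast; rfl
  have hrank : ∀ {μ : YoungDiagram}, μ.IsSelfConjugate → μ.bgRank =
      coreRank fun r => charge (μ.quotient τ r) := fun {μ} h => by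
    rw [coreRank, ← sum_neg_one_pow_mergeResidues, mergeResidues_quotient hτ, h.bgRank_eq]
  have hbij : ∑ μ ∈ (selfConjugateOfSize N).filter
        (fun μ => (μ.hookLengthsMod (2 * τ)).card = 2 * n ∧ μ.bgRank = j),
      ((μ.hookLengthsMod (2 * τ)).map fun h : ℕ => 1 / (h : ℚ)).prod =
      ∑ k ∈ piAntidiag (univ : Finset (Fin τ)) n,
        ∑ p ∈ Fintype.piFinset fun r => mayaDiagrams (c r) (k r), ∏ r, g (p r) := by
    rw [sum_sigma']
    refine sum_nbij'
      (fun μ => (⟨fun r => hookCount (μ.quotient τ r), μ.quotient τ⟩ :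
        Σ _ : Fin τ → ℕ, Fin τ → Finset ℕ × Finset ℕ))
      (fun x => ofDiagonalArms (mergeResidues τ x.2)) ?_ ?_ ?_ ?_ ?_
    · intro μ hμ
      rw [mem_filter, mem_selfConjugateOfSize] at hμ
      obtain ⟨⟨h, h1⟩, h2, h3⟩ := hμ
      rw [h.card_hookLengthsMod_eq hτ] at h2
      have h4 : ∑ r, hookCount (μ.quotient τ r) = n := by omega
      have h5 := hsize h
      rw [h1, hN, ← Nat.cast_sum, h4] at h5
      have h6 := hrank h
      rw [h3] at h6
      have h7 := eq_minimalCharges hτ (c := fun r => charge (μ.quotient τ r))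
        (by rw [← h6]; linarith)
      rw [← h6] at h7
      simp only [mem_sigma, mem_piAntidiag, Fintype.mem_piFinset, mem_mayaDiagrams]
      exact ⟨⟨h4, fun _ _ => mem_univ _⟩, fun r => ⟨congrFun h7 r, trivial⟩⟩
    · rintro ⟨k, p⟩ hx
      simp only [mem_sigma, mem_piAntidiag, Fintype.mem_piFinset, mem_mayaDiagrams] at hx
      obtain ⟨⟨h1, -⟩, h2⟩ := hx
      have h := isSelfConjugate_ofDiagonalArms (mergeResidues τ p)
      have h3 := hsize h
      have h4 := hrank h
      have h5 := h.card_hookLengthsMod_eq hτ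
      simp only [hsplit, (h2 _).1, (h2 _).2, ← Nat.cast_sum] at h3 h4 h5
      rw [h1] at h5
      rw [h1, hc, coreSize_minimalCharges hτ] at h3
      rw [hc, coreRank_minimalCharges hτ] at h4
      rw [mem_filter, mem_selfConjugateOfSize]
      exact ⟨⟨h, by zify; rw [h3, hN]; ring⟩, h5, h4⟩
    · intro μ hμ
      rw [mem_filter, mem_selfConjugateOfSize] at hμ
      exact diagonalArms_injOn (isSelfConjugate_ofDiagonalArms _) hμ.1.1
        (by rw [diagonalArms_ofDiagonalArms, mergeResidues_quotient hτ])
    · rintro ⟨k, p⟩ hx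
      simp only [mem_sigma, mem_piAntidiag, Fintype.mem_piFinset, mem_mayaDiagrams] at hx
      dsimp only
      rw [hsplit]
      congr 1
      funext r
      exact (hx.2 r).2
    · intro μ hμ
      rw [mem_filter, mem_selfConjugateOfSize] at hμ
      have := hμ.1.1.pow_mul_prod_hookLengthsMod hτ (1 : ℚ)
      rwa [one_pow, one_mul] at this
  rw [hbij]
  have hprod : ∀ k : Fin τ → ℕ,
      ∑ p ∈ Fintype.piFinset fun r => mayaDiagrams (c r) (k r), ∏ r, g (p r) =
        ∏ r, (1 / (2 * (τ : ℚ)) ^ 2) ^ k r / ((k r).factorial : ℚ) := fun k => by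
    rw [← prod_univ_sum]
    exact prod_congr rfl fun r _ => hsum _ _
  have hτ0 : (τ : ℚ) ≠ 0 := by exact_mod_cast hτ.ne'
  simp only [hprod]
  rw [sum_piAntidiag_div_factorial,
    show (τ : ℚ) * (1 / (2 * (τ : ℚ)) ^ 2) = 1 / (4 * τ) by field_simp; norm_num, div_pow, one_pow]
  rw [div_div, mul_comm]

end YoungDiagram

end

theorem corollary4p1 (t : ℕ) (ht : 0 < t) (hteven : Even t) :
    (∀ q x b : ℂ, ‖q‖ < 1 → b ≠ 0 →
      HasSum
        (fun μ : {μ : YoungDiagram // μ.IsSelfConjugate} =>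
          q ^ μ.1.card * x ^ (μ.1.hookLengthsMod t).card * b ^ μ.1.bgRank *
            ((μ.1.hookLengthsMod t).map fun h : ℕ => 1 / (h : ℂ)).prod)
        (qPochhammerInf (q ^ (2 * t)) (q ^ (2 * t)) ^ (t / 2) *
          qPochhammerInf (-(b * q)) (q ^ 4) *
          qPochhammerInf (-(q ^ 3 / b)) (q ^ 4) *
          Complex.exp (x ^ 2 * q ^ (2 * t) / (2 * (t : ℂ))))) ∧
    (∀ (j : ℤ) (n N : ℕ), (N : ℤ) = 2 * (t : ℤ) * (n : ℤ) + j * (2 * j - 1) →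
      ∑ μ ∈ (YoungDiagram.selfConjugateOfSize N).filter
          (fun μ => (μ.hookLengthsMod t).card = 2 * n ∧ μ.bgRank = j),
        ((μ.hookLengthsMod t).map fun h : ℕ => 1 / (h : ℚ)).prod
      = 1 / ((n.factorial : ℚ) * 2 ^ n * (t : ℚ) ^ n)) := by
  obtain ⟨τ, rfl⟩ := even_iff_exists_two_mul.1 hteven
  have hτ : 0 < τ := by omega
  refine ⟨fun q x b hq hb => ?_, fun j n N hN => ?_⟩
  · have h4 : 2 * (2 * τ) = 4 * τ := by ring
    have h4' : (2 : ℂ) * ((2 * τ : ℕ) : ℂ) = 4 * τ := by push_cast; ring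
    rw [Nat.mul_div_cancel_left τ two_pos, h4, h4']
    rcases eq_or_ne q 0 with rfl | hq0
    · have h0 : (0 : ℂ) ^ (4 * τ) = 0 := zero_pow (by omega)
      convert hasSum_selfConjugate_zero x b (2 * τ) using 1
      simp [h0, qPochhammerInf]
    · exact hasSum_selfConjugate_of_ne_zero hq hq0 hb x hτ
  · rw [YoungDiagram.sum_selfConjugate_minimal hτ j n N (by rw [hN]; push_cast; ring),
      mul_assoc (n.factorial : ℚ), ← mul_pow]
    push_cast
    congr 3
    ring
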